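/- Let $X$ be a smooth projective complex surface and let $\mathsf{Aff}$ be the category of affine $\mathbb{C}$-schemes. For $S\in\mathsf{Aff}$, a relative effective Cartier divisor on a scheme $Y/S$ is a closed subscheme of $Y$ that is flat over $S$ and whose ideal is locally generated by one nonzerodivisor; $+$ is the sum of divisors, and $\cap$, $\cup$ denote the scheme-theoretic intersection and union of closed subschemes. A *flag* over $S$ is a pair $(D,Z)$ with $D$ a relative effective Cartier divisor on $X\times S/S$ and $Z\subset D$ a closed subscheme of $X \times S$ that is finite, flat and of finite presentation over $S$ (possibly empty). Flags over $S$ form a poset $\underline{\mathsf{Fl}}_X(S)$: $(D',Z')\le(D,Z)$ iff $D'\subset D$, $Z'\subset Z$ and $Z'\to D'\cap Z$ is an isomorphism on reduced subschemes. A pair of flags $((D,Z),(D',Z'))$ is *good* if $D\cap D'$ is a relative effective Cartier divisor both on $D/S$ and on $D'/S$, and $D\cap D'=Z\cap Z'$; put $(D,Z)\cup(D',Z')=(D+D',Z\cup Z')$. Let $\underline{\mathsf{Fl}}_{X,0}(S)=*$, $\underline{\mathsf{Fl}}_{X,1}(S)=\underline{\mathsf{Fl}}_X(S)$, let $\underline{\mathsf{Fl}}_{X,2}(S)$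 be the set of good pairs of flags, and for $n\ge3$ let $\underline{\mathsf{Fl}}_{X,n}(S)$ be, inductively, the set of $n$-tuples of flags $(F_1,\dots,F_n)$ such that $(F_2,\dots,F_n)$, $(F_1,\dots,F_{n-1})$ and all $(F_1,\dots,F_i\cup F_{i+1},\dots,F_n)$, $1\le i\le n-1$, lie in $\underline{\mathsf{Fl}}_{X,n-1}(S)$; all these sets carry the componentwise order. Then the following hold. 1. With inverse images as functoriality in $S$, with the face maps $\partial_i:\underline{\mathsf{Fl}}_{X,n}\to\underline{\mathsf{Fl}}_{X,n-1}$ that drop $F_1$ for $i=0$, drop $F_n$ for $i=n$ and replace $F_i,F_{i+1}$ by $F_i\cup F_{i+1}$ for $0<i<n$, and with the degeneracies that insert the empty flag $(\emptyset,\emptyset)$, these posets form a simplicial object $\underline{\mathsf{Fl}}_{X,\bullet}$ in the category of functors $\mathsf{Aff}^{\mathrm{op}}\to\mathbf{PoSets}$ (in particular, all these maps are well defined and order preserving). 2. $\underline{\mathsf{Fl}}_{X,\bullet}$ is a $2$-Segal object: for all $0\le i<j\le n$, the canonical map $\underline{\mathsf{Fl}}_{X,n}\to\underline{\mathsf{Fl}}_{X,\{0,\dots,i,j,\dots,n\}}\times_{\underline{\mathsf{Fl}}_{X,\{i,j\}}}\underline{\mathsf{Fl}}_{X,\{i,\dots,j\}}$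 is an isomorphism. Moreover, for all $0<i<n$ and all $S$, the squares of posets given by $\partial_0\partial_{i+1}=\partial_i\partial_0$ and by $\partial_n\partial_i=\partial_i\partial_{n+1}$, from $\underline{\mathsf{Fl}}_{X,n+1}(S)$ to $\underline{\mathsf{Fl}}_{X,n-1}(S)$, are strictly Cartesian. 3. Any two distinct members $F_i$, $F_j$ ($i\ne j$) of a tuple in $\underline{\mathsf{Fl}}_{X,n}(S)$ form a good pair. 4. The union is a partially defined unital associative monoid structure on flags: the union of a good pair of flags is a flag; $(F,\emptyset)$ and $(\emptyset,F)$ are good with union $F$ for every flag $F$; and $(F,G)$ and $(F\cup G,H)$ are good if and only if $(G,H)$ and $(F,G\cup H)$ are good, in which case $(F\cup G)\cup H=F\cup(G\cup H)$. (The Cartesian squares of part 2 with $n=2$, $i=1$ express the associativity of the correspondence $\underline{\mathsf{Fl}}_{X,1}\times\underline{\mathsf{Fl}}_{X,1}\leftarrow\underline{\mathsf{Fl}}_{X,2}\xrightarrow{\cup}\underline{\mathsf{Fl}}_{X,1}$.) -/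

import Mathlib

open CategoryTheory CategoryTheory.Limits AlgebraicGeometry Opposite
open scoped Simplicial

noncomputable section

namespace FlagSegal

/-! ### Smooth projective complex surfaces and affine test schemes -/

/-- The base scheme `Spec ℂ`. -/
abbrev SpecC : Scheme.{0} := Spec (CommRingCat.of ℂ)

section Projective

attribute [local instance] MvPolynomial.gradedAlgebra

/-- Projective `n`-space over `ℂ`, as the homogeneous spectrum of `ℂ[x₀, …, xₙ]`. -/
def projectiveSpace (n : ℕ) : Scheme.{0} :=
  Proj (MvPolynomial.homogeneousSubmodule (Fin (n + 1)) ℂ)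

/-- The structure morphism `ℙⁿ ⟶ Spec ℂ`. -/
def projectiveSpaceHom (n : ℕ) : projectiveSpace n ⟶ SpecC :=
  Proj.toSpecZero (MvPolynomial.homogeneousSubmodule (Fin (n + 1)) ℂ) ≫
    Spec.map (CommRingCat.ofHom
      (algebraMap ℂ (MvPolynomial.homogeneousSubmodule (Fin (n + 1)) ℂ 0)))

end Projective

/-- A smooth projective complex surface: a `ℂ`-scheme, smooth of relative dimension `2`, which is
a closed subscheme of some projective space over `ℂ`. -/
structure IsSmoothProjectiveSurface (X : Over SpecC) : Prop where
  smooth : SmoothOfRelativeDimension 2 X.hom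
  projective : ∃ (n : ℕ) (i : X.left ⟶ projectiveSpace n),
    IsClosedImmersion i ∧ i ≫ projectiveSpaceHom n = X.hom

/-- The category of affine `ℂ`-schemes. -/
abbrev AffC : Type 1 :=
  ObjectProperty.FullSubcategory (fun S : Over SpecC => IsAffine S.left)

/-- The scheme `X × S` (fibre product over `Spec ℂ`). -/
abbrev prodScheme (X : Over SpecC) (S : AffC) : Scheme.{0} :=
  pullback X.hom S.obj.hom

/-- The projection `X × S ⟶ S`. -/
abbrev proj (X : Over SpecC) (S : AffC) : prodScheme X S ⟶ S.obj.left :=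
  pullback.snd X.hom S.obj.hom

/-- The morphism `id × f : X × S ⟶ X × T` induced by `f : S ⟶ T`. -/
def prodMap (X : Over SpecC) {S T : AffC} (f : S ⟶ T) : prodScheme X S ⟶ prodScheme X T :=
  pullback.lift (pullback.fst X.hom S.obj.hom) (proj X S ≫ f.hom.left)
    (by rw [Category.assoc, Over.w f.hom]; exact pullback.condition)

/-! ### Divisors and zero-dimensional families

A closed subscheme of `Y` is given by its quasi-coherent ideal sheaf `I : Y.IdealSheafData`; the
subscheme itself is `I.subscheme`, with inclusion `I.subschemeι`.  Inclusion of closed subschemes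
is the reverse inclusion `≥` of ideal sheaves, their intersection is `⊔`, their union is `⊓`, the
sum of effective Cartier divisors is the product `*` of ideal sheaves, the reduced subscheme is
`I.radical`, the inverse image along `f` is `I.comap f`, and the empty subscheme is `⊤`. -/

/-- Effective Cartier divisors: closed subschemes whose ideal is, locally, generated by one
nonzerodivisor. -/
def IsEffectiveCartier {Y : Scheme.{0}} (I : Y.IdealSheafData) : Prop :=
  ∀ y : Y, ∃ U : Y.affineOpens, y ∈ U.1 ∧
    ∃ f ∈ nonZeroDivisors Γ(Y, U), I.ideal U = Ideal.span {f}

/-- Relative effective Cartier divisors on `Y / S`: effective Cartier divisors of `Y` that are flat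
over `S`. -/
structure IsRelEffectiveCartier {Y S : Scheme.{0}} (p : Y ⟶ S) (I : Y.IdealSheafData) : Prop where
  cartier : IsEffectiveCartier I
  flat : Flat (I.subschemeι ≫ p)

/-- Families of zero-dimensional (possibly empty) closed subschemes of `Y` over `S`: closed
subschemes which are finite, flat and of finite presentation over `S`. -/
structure IsZeroDimFamily {Y S : Scheme.{0}} (p : Y ⟶ S) (I : Y.IdealSheafData) : Prop where
  finite : IsFinite (I.subschemeι ≫ p)
  flat : Flat (I.subschemeι ≫ p)
  finitePresentation : LocallyOfFinitePresentation (I.subschemeι ≫ p)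

/-! ### Flags, good pairs, unions -/

/-- A pair `(D, Z)` of closed subschemes of `Y`, each given by its ideal sheaf. -/
@[ext]
structure SubPair (Y : Scheme.{0}) : Type where
  D : Y.IdealSheafData
  Z : Y.IdealSheafData

namespace SubPair

variable {Y Y' S : Scheme.{0}}

/-- The pair `(∅, ∅)`. -/
def empty (Y : Scheme.{0}) : SubPair Y := ⟨⊤, ⊤⟩

/-- The pair `(D + D', Z ∪ Z')`. -/
def union (F G : SubPair Y) : SubPair Y := ⟨F.D * G.D, F.Z ⊓ G.Z⟩

/-- The inverse image of a pair. -/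
def comap (F : SubPair Y) (f : Y' ⟶ Y) : SubPair Y' := ⟨F.D.comap f, F.Z.comap f⟩

/-- `(D, Z)` is a (family of) flag(s) on `Y` relative to `S`: `D` is a relative effective Cartier
divisor, `Z` is a family of zero-dimensional subschemes, and `Z ⊂ D`. -/
structure IsFlag (p : Y ⟶ S) (F : SubPair Y) : Prop where
  divisor : IsRelEffectiveCartier p F.D
  zeroDim : IsZeroDimFamily p F.Z
  nested : F.D ≤ F.Z

/-- The order of flags: `(D', Z') ≤ (D, Z)` iff `D' ⊂ D`, `Z' ⊂ Z`, and the closed immersion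
`Z' ⟶ D' ∩ Z` is an isomorphism on reduced subschemes. -/
structure FlagLE (F' F : SubPair Y) : Prop where
  divisor : F.D ≤ F'.D
  points : F.Z ≤ F'.Z
  red : F'.Z.radical = (F'.D ⊔ F.Z).radical

/-- Two relative effective Cartier divisors `D`, `D'` on `Y / S` are in good position: `D ∩ D'` is
a relative effective Cartier divisor both on `D / S` and on `D' / S`. -/
structure IsGoodDivisors (p : Y ⟶ S) (D D' : Y.IdealSheafData) : Prop where
  left : IsRelEffectiveCartier (D.subschemeι ≫ p) (D'.comap D.subschemeι)
  right : IsRelEffectiveCartier (D'.subschemeι ≫ p) (D.comap D'.subschemeι)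

/-- Good pairs of flags: both are flags, their divisors are in good position, and
`D ∩ D' = Z ∩ Z'`. -/
structure IsGood (p : Y ⟶ S) (F F' : SubPair Y) : Prop where
  flag_left : IsFlag p F
  flag_right : IsFlag p F'
  divisors : IsGoodDivisors p F.D F'.D
  inter : F.D ⊔ F'.D = F.Z ⊔ F'.Z

/-- The `i`-th face of `(F₁, …, Fₙ₊₁)`: it drops `F₁` if `i = 0`, drops `Fₙ₊₁` if `i = n + 1`, and
replaces `Fᵢ, Fᵢ₊₁` by `Fᵢ ∪ Fᵢ₊₁` otherwise.  (The entries are indexed from `0` in the code.) -/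
def face {n : ℕ} (i : Fin (n + 2)) (F : Fin (n + 1) → SubPair Y) : Fin n → SubPair Y := fun j =>
  if j.val + 1 < i.val then F j.castSucc
  else if j.val + 1 = i.val then union (F j.castSucc) (F j.succ)
  else F j.succ

/-- The `i`-th degeneracy of `(F₁, …, Fₙ)`, namely `(F₁, …, Fᵢ, ∅, Fᵢ₊₁, …, Fₙ)`. -/
def degeneracy {n : ℕ} (i : Fin (n + 1)) (F : Fin n → SubPair Y) : Fin (n + 1) → SubPair Y :=
  Fin.insertNth (α := fun _ => SubPair Y) i (empty Y) F

/-- The `n`-tuples that form the `n`-th level: one point for `n = 0`, flags for `n = 1`, good pairs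
of flags for `n = 2`, and for `n ≥ 3`, inductively, the tuples of flags all of whose faces belong to
level `n - 1`. -/
def IsFlagTuple (p : Y ⟶ S) (n : ℕ) (F : Fin n → SubPair Y) : Prop :=
  match n, F with
  | 0, _ => True
  | 1, F => IsFlag p (F 0)
  | 2, F => IsGood p (F 0) (F 1)
  | n + 3, F => (∀ i, IsFlag p (F i)) ∧ ∀ i : Fin (n + 4), IsFlagTuple p (n + 2) (face i F)

lemma IsFlagTuple.isFlag {p : Y ⟶ S} {n : ℕ} {F : Fin n → SubPair Y}
    (h : IsFlagTuple p n F) (i : Fin n) : IsFlag p (F i) := by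
  match n, F, h, i with
  | 1, _, h, 0 => exact h
  | 2, _, h, 0 => exact h.flag_left
  | 2, _, h, 1 => exact h.flag_right
  | _ + 3, _, h, i => exact h.1 i

lemma FlagLE.refl {p : Y ⟶ S} {F : SubPair Y} (h : IsFlag p F) : FlagLE F F :=
  ⟨le_rfl, le_rfl, by rw [sup_eq_right.2 h.nested]⟩

lemma FlagLE.trans {F G H : SubPair Y} (h₁ : FlagLE F G) (h₂ : FlagLE G H) : FlagLE F H := by
  refine ⟨h₂.divisor.trans h₁.divisor, h₂.points.trans h₁.points, ?_⟩
  have e₁ := h₁.red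
  rw [Scheme.IdealSheafData.radical_sup, h₂.red, ← Scheme.IdealSheafData.radical_sup,
    ← sup_assoc, sup_eq_left.2 h₁.divisor] at e₁
  exact e₁

lemma FlagLE.antisymm {F G : SubPair Y} (h₁ : FlagLE F G) (h₂ : FlagLE G F) : F = G :=
  SubPair.ext (le_antisymm h₂.divisor h₁.divisor) (le_antisymm h₂.points h₁.points)

end SubPair

open SubPair

/-- The `n`-th level at a fixed base. -/
def FlagTuple {Y S : Scheme.{0}} (p : Y ⟶ S) (n : ℕ) : Type :=
  {F : Fin n → SubPair Y // IsFlagTuple p n F}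

/-- The order of the `n`-th level: the componentwise order of flags. -/
instance {Y S : Scheme.{0}} (p : Y ⟶ S) (n : ℕ) : PartialOrder (FlagTuple p n) where
  le F G := ∀ i, FlagLE (F.1 i) (G.1 i)
  le_refl F i := FlagLE.refl (F.2.isFlag i)
  le_trans _ _ _ h₁ h₂ i := (h₁ i).trans (h₂ i)
  le_antisymm _ _ h₁ h₂ := Subtype.ext (funext fun i => (h₁ i).antisymm (h₂ i))

/-! ### The simplicial object of flags -/

/-- `Fl` is, under the identifications `e` of its values with the posets of flag tuples, *the*
simplicial object of flags on `X`: the functoriality in the test scheme is by inverse image, and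
the faces and the degeneracies are given by the formulas `face` and `degeneracy`. -/
structure IsFlagSimplicialObject (X : Over SpecC)
    (Fl : SimplicialObject (AffCᵒᵖ ⥤ PartOrd.{0}))
    (e : ∀ (n : ℕ) (S : AffC), (Fl _⦋n⦌).obj (op S) ≃o FlagTuple (proj X S) n) : Prop where
  pullback : ∀ (n : ℕ) {S T : AffC} (f : S ⟶ T) (x : (Fl _⦋n⦌).obj (op T)) (j : Fin n),
    (e n S ((Fl _⦋n⦌).map f.op x)).1 j = ((e n T x).1 j).comap (prodMap X f)
  face : ∀ (n : ℕ) (i : Fin (n + 2)) (S : AffC) (x : (Fl _⦋n + 1⦌).obj (op S)),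
    (e n S ((Fl.δ i).app (op S) x)).1 = SubPair.face i (e (n + 1) S x).1
  degeneracy : ∀ (n : ℕ) (i : Fin (n + 1)) (S : AffC) (x : (Fl _⦋n⦌).obj (op S)),
    (e (n + 1) S ((Fl.σ i).app (op S) x)).1 = SubPair.degeneracy i (e n S x).1

/-! ### 2-Segal objects -/

/-- `[m] ⟶ [a + m + b]`, the inclusion of the interval `{a, …, a + m}`. -/
def innerMap (a m b : ℕ) : SimplexCategory.mk m ⟶ SimplexCategory.mk (a + m + b) :=
  SimplexCategory.mkHom
    { toFun := fun k => ⟨a + k.val, by have := k.isLt; omega⟩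
      monotone' := fun k l h => by
        have : k.val ≤ l.val := h
        exact Fin.mk_le_mk.2 (by omega) }

/-- `[a + 1 + b] ⟶ [a + m + b]`, the inclusion of `{0, …, a, a + m, …, a + m + b}` (`1 ≤ m`). -/
def outerMap (a m b : ℕ) (hm : 1 ≤ m) :
    SimplexCategory.mk (a + 1 + b) ⟶ SimplexCategory.mk (a + m + b) :=
  SimplexCategory.mkHom
    { toFun := fun k => ⟨if k.val ≤ a then k.val else k.val - 1 + m, by
        have := k.isLt
        split_ifs <;> omega⟩
      monotone' := fun k l h => by
        have : k.val ≤ l.val := h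
        refine Fin.mk_le_mk.2 ?_
        split_ifs <;> omega }

/-- `[1] ⟶ [m]`, `0 ↦ 0`, `1 ↦ m`. -/
def edgeMap (m : ℕ) : SimplexCategory.mk 1 ⟶ SimplexCategory.mk m :=
  SimplexCategory.mkHom
    { toFun := fun k => ⟨k.val * m, by
        have h : k.val ≤ 1 := by omega
        have : k.val * m ≤ 1 * m := Nat.mul_le_mul_right m h
        omega⟩
      monotone' := fun k l h => Fin.mk_le_mk.2 (Nat.mul_le_mul_right m h) }

/-- A simplicial object `X` is 2-Segal if for all `0 ≤ i < j ≤ n` (with `i = a`, `j = a + m`,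
`n = a + m + b`) the square
`Xₙ ⟶ X_{0, …, i, j, …, n} ⟶ X_{i, j} ⟵ X_{i, …, j} ⟵ Xₙ` is Cartesian. -/
def IsTwoSegal {C : Type*} [Category C] (X : SimplicialObject C) : Prop :=
  ∀ (a m b : ℕ) (hm : 1 ≤ m),
    IsPullback (X.map (outerMap a m b hm).op) (X.map (innerMap a m b).op)
      (X.map (innerMap a 1 b).op) (X.map (edgeMap m).op)

end FlagSegal

end

/-!
The union `(D, Z) ∪ (D', Z') = (D + D', Z ∪ Z')` makes all pairs of closed subschemes of `Y` a
commutative monoid (`SubPair Y`, with unit the empty pair), so that unions never have to be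
rebracketed by hand; the content is in the relation `IsGood p`, which says when a union is defined.
The geometric heart is `isPartialCommMonoid_isGood`: goodness is symmetric and unital, unions of
good pairs are flags, and if `(F, G)` and `(F ∪ G, H)` are good, then so are `(G, H)` and
`(F, G ∪ H)`. Of `X` it is only used that `X × S` is separated and of finite presentation over the
affine scheme `S`.

*Local form of goodness.* On affine opens where `D = (f)`, `D' = (g)`, the condition that `D ∩ D'`
is a relative Cartier divisor on both sides says that `g` is a nonzerodivisor modulo `f` and
`A / (f, g)` is flat over the base (`isGoodDivisors_iff`). Then `Z ∪ Z'` is flat by the sequence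
`0 → A / (I ∩ J) → A / I × A / J → A / (I + J) → 0`, because `I + J = (f, g)` by the condition
`D ∩ D' = Z ∩ Z'`. It is of finite presentation because `(f, g)` is finitely presented (Koszul) and
it is finite because it is dominated by `Z ⊔ Z'`, hence proper and quasi-finite (`isFlag_union`).

*Associativity.* Nonzerodivisors modulo `h` are closed under products and factors, and the same
holds after tensoring with any module over the base, which gives the flatness conditions
(`flat_of_flat_mul`, `flat_mul_of_flat`). The conditions on the points are identities of ideals,
`sup_eq_span_sup_span_of_mul` and `span_sup_span_mul_eq`. The converse follows by commutativity.

*Base change.* Inverse images commute with the unions of good pairs (`comap_union`): intersecting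
`I` and `J` commutes with base change because `A / (I + J)` is flat. The condition on
reduced subschemes in the order of flags is one on supports, and a computation with closed subsets
shows that inverse images and unions of good pairs are monotone.

*Combinatorics.* For a tuple `F` let `segProd F x y` be the union of the `F k` with `x ≤ k < y`. A
tuple is a flag tuple iff for all `x ≤ y ≤ z` the pair `(segProd F x y, segProd F y z)` is good
(`isFlagTuple_iff`); by associativity, it is enough to know this for the triples `0, k, k + 1`. In
this form a monotone map `φ` acts on tuples by `(φ* F) j = segProd F (φ j) (φ (j + 1))`
(`simplexAct`), as in the nerve of a monoid; this is functorial, and faces and degeneracies are the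
expected ones. The Segal squares are Cartesian since every edge `{j, j + 1}` of the big simplex lies
in one of the two faces, so that the glued tuple is determined, and the missing conditions on it
follow from associativity on quadrilaterals (`IsPartialCommMonoid.quad'`).
-/

namespace FlagSegal

open SubPair

/-! ### Partially defined commutative monoids and composable tuples -/

section PartialMonoid

variable {M : Type*} [CommMonoid M]

/-- A relation `r` (read: "the product of `a` and `b` is defined") turns the commutative monoid `M`
into a partially defined commutative monoid. Its elements are those `a` with `r a 1`. -/
structure IsPartialCommMonoid (r : M → M → Prop) : Prop where
  symm : ∀ {a b}, r a b → r b a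
  one_one : r 1 1
  left : ∀ {a b}, r a b → r a 1
  mul : ∀ {a b}, r a b → r (a * b) 1
  assoc : ∀ {a b c}, r a b → r (a * b) c → r b c ∧ r a (b * c)

/-- The product of the entries `F k` with `x ≤ k < y`. Entries with index `k ≥ n` count as `1`. -/
def segProd {n : ℕ} (F : Fin n → M) (x y : ℕ) : M :=
  ∏ k ∈ Finset.Ico x y, if h : k < n then F ⟨k, h⟩ else 1

/-- All consecutive segments of the tuple `F` have a defined product. -/
def IsComposable (r : M → M → Prop) {n : ℕ} (F : Fin n → M) : Prop :=
  ∀ x y z : ℕ, x ≤ y → y ≤ z → z ≤ n → r (segProd F x y) (segProd F y z)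

variable {n m l : ℕ} (F : Fin n → M)

@[simp]
lemma segProd_self (x : ℕ) : segProd F x x = 1 := by simp [segProd]

lemma segProd_mul {x y z : ℕ} (h₁ : x ≤ y) (h₂ : y ≤ z) :
    segProd F x y * segProd F y z = segProd F x z :=
  Finset.prod_Ico_consecutive _ h₁ h₂

lemma segProd_succ {x : ℕ} (h : x < n) : segProd F x (x + 1) = F ⟨x, h⟩ := by
  simp [segProd, h]

lemma segProd_succ' {x y : ℕ} (h : x < n) (hy : y = x + 1) : segProd F x y = F ⟨x, h⟩ := by
  rw [hy, segProd_succ]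

/-- The tuple whose `j`-th entry is the product of the entries of `F` between `φ j` and
`φ (j + 1)`: the action of a monotone map on tuples, as in the nerve of a monoid. -/
def simplexAct (φ : Fin (m + 1) →o Fin (n + 1)) (F : Fin n → M) : Fin m → M := fun j =>
  segProd F (φ j.castSucc) (φ j.succ)

lemma segProd_simplexAct (φ : Fin (m + 1) →o Fin (n + 1)) {x y : ℕ} (hx : x ≤ y)
    (hy : y < m + 1) :
    segProd (simplexAct φ F) x y = segProd F (φ ⟨x, by omega⟩) (φ ⟨y, hy⟩) := by
  induction y, hx using Nat.le_induction with
  | base => simp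
  | succ k hk ih =>
    rw [← segProd_mul _ hk (Nat.le_succ k), ih (by omega), segProd_succ _ (by omega)]
    exact segProd_mul _ (φ.monotone (Fin.mk_le_mk.2 hk)) (φ.monotone (Fin.mk_le_mk.2 (by simp)))

lemma simplexAct_comp (φ : Fin (m + 1) →o Fin (n + 1)) (ψ : Fin (l + 1) →o Fin (m + 1)) :
    simplexAct (φ.comp ψ) F = simplexAct ψ (simplexAct φ F) := by
  funext j
  exact (segProd_simplexAct F φ (ψ.monotone (Fin.castSucc_le_succ j)) (Fin.is_lt _)).symm

lemma simplexAct_id : simplexAct OrderHom.id F = F := by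
  funext j
  exact segProd_succ F j.is_lt

variable {r : M → M → Prop} {F}

lemma IsComposable.simplexAct (h : IsComposable r F) (φ : Fin (m + 1) →o Fin (n + 1)) :
    IsComposable r (simplexAct φ F) := by
  intro x y z hxy hyz hz
  rw [segProd_simplexAct F φ hxy (by omega), segProd_simplexAct F φ hyz (by omega)]
  exact h _ _ _ (φ.monotone (Fin.mk_le_mk.2 hxy)) (φ.monotone (Fin.mk_le_mk.2 hyz))
    (by omega)

lemma val_succAbove (i : Fin (n + 1)) (k : Fin n) :
    (i.succAbove k).val = if k.val < i.val then k.val else k.val + 1 := by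
  simp only [Fin.succAbove, Fin.lt_def, Fin.val_castSucc]
  split_ifs <;> simp

/-- A face of `F` knows about the segments whose endpoints are different from the omitted vertex. -/
lemma IsComposable.of_face {F : Fin (n + 1) → M} {i : Fin (n + 2)}
    (h : IsComposable r (FlagSegal.simplexAct (Fin.succAboveOrderEmb i).toOrderHom F)) {x y z : ℕ}
    (hxy : x ≤ y) (hyz : y ≤ z) (hz : z ≤ n + 1) (hx : x ≠ i) (hy : y ≠ i) (hz' : z ≠ i) :
    r (segProd F x y) (segProd F y z) := by
  have key : ∀ (k : ℕ) (hk : k ≤ n + 1), k ≠ i →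
      ∃ k' : Fin (n + 1), ((Fin.succAboveOrderEmb i).toOrderHom k').val = k ∧
        k'.val = if k < i then k else k - 1 := by
    intro k hk hki
    have hi := i.is_lt
    refine ⟨⟨if k < i then k else k - 1, by split_ifs <;> omega⟩, ?_, rfl⟩
    change (i.succAbove _).val = k
    rw [val_succAbove]
    simp only
    split_ifs <;> omega
  obtain ⟨x', hx₁, hx₂⟩ := key x (by omega) hx
  obtain ⟨y', hy₁, hy₂⟩ := key y (by omega) hy
  obtain ⟨z', hz₁, hz₂⟩ := key z (by omega) hz'
  have hxy' : x'.val ≤ y'.val := by rw [hx₂, hy₂]; split_ifs <;> omega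
  have hyz' : y'.val ≤ z'.val := by rw [hy₂, hz₂]; split_ifs <;> omega
  have := h x' y' z' hxy' hyz' (by omega)
  rwa [segProd_simplexAct F _ hxy' y'.is_lt, segProd_simplexAct F _ hyz' z'.is_lt, hx₁, hy₁,
    hz₁] at this

namespace IsPartialCommMonoid

variable (hr : IsPartialCommMonoid r)
include hr

/-- The converse of associativity, by commutativity. -/
lemma assoc' {a b c : M} (h₁ : r b c) (h₂ : r a (b * c)) : r a b ∧ r (a * b) c := by
  have := hr.assoc (hr.symm h₁) (by rw [mul_comm]; exact hr.symm h₂)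
  rw [mul_comm b a] at this
  exact ⟨hr.symm this.1, hr.symm this.2⟩

/-- Two opposite triangulations of the quadrilateral `w ≤ x ≤ y ≤ z`. -/
lemma quad {w x y z : ℕ} (hwx : w ≤ x) (hxy : x ≤ y) (hyz : y ≤ z)
    (h₁ : r (segProd F w x) (segProd F x y)) (h₂ : r (segProd F w y) (segProd F y z)) :
    r (segProd F x y) (segProd F y z) ∧ r (segProd F w x) (segProd F x z) := by
  rw [← segProd_mul F hwx hxy] at h₂
  rw [← segProd_mul F hxy hyz]
  exact hr.assoc h₁ h₂

lemma quad' {w x y z : ℕ} (hwx : w ≤ x) (hxy : x ≤ y) (hyz : y ≤ z)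
    (h₁ : r (segProd F x y) (segProd F y z)) (h₂ : r (segProd F w x) (segProd F x z)) :
    r (segProd F w x) (segProd F x y) ∧ r (segProd F w y) (segProd F y z) := by
  rw [← segProd_mul F hxy hyz] at h₂
  rw [← segProd_mul F hwx hxy]
  exact hr.assoc' h₁ h₂

/-- It is enough to multiply the entries one after the other. -/
lemma isComposable_of_chain (h : ∀ k < n, r (segProd F 0 k) (segProd F k (k + 1))) :
    IsComposable r F := by
  have h0 : ∀ y, y ≤ n → r (segProd F 0 y) 1 := by
    intro y hy
    cases y with
    | zero => simpa using hr.one_one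
    | succ k => simpa [segProd_mul F (Nat.zero_le k) (Nat.le_succ k)] using hr.mul (h k hy)
  have h1 : ∀ y, y ≤ n → ∀ x ≤ y, r (segProd F 0 x) (segProd F x y) := by
    intro y
    induction y with
    | zero =>
      intro _ x hx
      obtain rfl : x = 0 := by omega
      simpa using hr.one_one
    | succ y ih =>
      intro hy x hx
      rcases Nat.lt_or_ge y x with hxy | hxy
      · obtain rfl : x = y + 1 := by omega
        simpa using h0 _ hy
      · exact (hr.quad (Nat.zero_le x) hxy (Nat.le_succ y) (ih (by omega) x hxy)
          (h y (by omega))).2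
  intro x y z hxy hyz hz
  exact (hr.quad (Nat.zero_le x) hxy hyz (h1 y (by omega) x hxy) (h1 z hz y hyz)).1

/-- Any two distinct entries of a composable tuple can be multiplied. -/
lemma pairwise (h : IsComposable r F) {i j : Fin n} (hij : i ≠ j) : r (F i) (F j) := by
  wlog hlt : i < j generalizing i j
  · exact hr.symm (this hij.symm (lt_of_le_of_ne (not_lt.1 hlt) hij.symm))
  have hlt' : i.val + 1 ≤ j.val := hlt
  have hi : segProd F i (i + 1) = F i := segProd_succ F i.is_lt
  have hj : segProd F j (j + 1) = F j := segProd_succ F j.is_lt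
  have h₁ := h i (i + 1) j (by omega) hlt' (by omega)
  have h₂ := h i j (j + 1) (by omega) (by omega) (by omega)
  rw [← segProd_mul F (Nat.le_succ _) hlt', hi, hj, mul_comm] at h₂
  rw [hi] at h₁
  exact (hr.assoc (hr.symm h₁) h₂).1

/-- Subdividing the edge `{a, a + m}` of a composable `(a + 1 + b)`-tuple by a composable `m`-tuple
gives a composable tuple. -/
lemma isComposable_of_outer_inner {a m b : ℕ} {F : Fin (a + m + b) → M}
    (hout : ∀ x y z : ℕ, x ≤ y → y ≤ z → z ≤ a + m + b → (x ≤ a ∨ a + m ≤ x) →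
      (y ≤ a ∨ a + m ≤ y) → (z ≤ a ∨ a + m ≤ z) → r (segProd F x y) (segProd F y z))
    (hin : ∀ x y z : ℕ, x ≤ y → y ≤ z → a ≤ x → z ≤ a + m → r (segProd F x y) (segProd F y z)) :
    IsComposable r F := by
  refine hr.isComposable_of_chain fun k hk => ?_
  by_cases h₁ : k + 1 ≤ a
  · exact hout _ _ _ (by omega) (by omega) (by omega) (by omega) (by omega) (by omega)
  by_cases h₂ : a + m ≤ k
  · exact hout _ _ _ (by omega) (by omega) (by omega) (by omega) (by omega) (by omega)
  have h₃ : r (segProd F 0 a) (segProd F a (k + 1)) :=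
    (hr.quad' (z := a + m) (by omega) (by omega) (by omega)
      (hin a (k + 1) (a + m) (by omega) (by omega) (by omega) (by omega))
      (hout 0 a (a + m) (by omega) (by omega) (by omega) (by omega) (by omega) (by omega))).1
  exact (hr.quad' (by omega) (by omega) (by omega)
    (hin a k (k + 1) (by omega) (by omega) (by omega) (by omega)) h₃).2

end IsPartialCommMonoid

end PartialMonoid

/-! ### Exact sequences and flat modules -/

section Flat

open TensorProduct

universe u

variable {R : Type u} [CommRing R] {M₁ M₂ M₃ : Type u} [AddCommGroup M₁] [AddCommGroup M₂]
  [AddCommGroup M₃] [Module R M₁] [Module R M₂] [Module R M₃]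
  {i : M₁ →ₗ[R] M₂} {p : M₂ →ₗ[R] M₃}

lemma rTensor_lTensor_apply {N N' M M' : Type*} [AddCommGroup N] [AddCommGroup N']
    [AddCommGroup M] [AddCommGroup M'] [Module R N] [Module R N'] [Module R M] [Module R M']
    (f : N →ₗ[R] N') (g : M →ₗ[R] M') (x : N ⊗[R] M) :
    f.rTensor M' (g.lTensor N x) = g.lTensor N' (f.rTensor M x) := by
  rw [← LinearMap.comp_apply, ← LinearMap.comp_apply, LinearMap.rTensor_comp_lTensor,
    LinearMap.lTensor_comp_rTensor]

/-- If the cokernel of an injection is flat, then the injection is universally injective: this is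
the vanishing of `Tor₁` of the cokernel. -/
lemma lTensor_injective_of_flat_coker (hi : Function.Injective i) (hip : Function.Exact i p)
    (hp : Function.Surjective p) [Module.Flat R M₃] (N : Type u) [AddCommGroup N] [Module R N] :
    Function.Injective (i.lTensor N) := by
  -- a free presentation `K → P → N`
  obtain ⟨P, K, _, _, _, _, κ, π, _, hκ, hκπ, hπ⟩ :
      ∃ (P K : Type u) (_ : AddCommGroup P) (_ : AddCommGroup K) (_ : Module R P) (_ : Module R K)
        (κ : K →ₗ[R] P) (π : P →ₗ[R] N), Module.Flat R P ∧ Function.Injective κ ∧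
        Function.Exact κ π ∧ Function.Surjective π :=
    ⟨N →₀ R, LinearMap.ker (Finsupp.linearCombination R (id : N → N)), inferInstance,
      inferInstance, inferInstance, inferInstance, Submodule.subtype _,
      Finsupp.linearCombination R id, inferInstance, Subtype.val_injective,
      LinearMap.exact_subtype_ker_map _, Finsupp.linearCombination_id_surjective R N⟩
  rw [injective_iff_map_eq_zero]
  intro x hx
  obtain ⟨y, rfl⟩ := LinearMap.rTensor_surjective M₁ hπ x
  rw [← rTensor_lTensor_apply] at hx
  obtain ⟨z, hz⟩ := (rTensor_exact M₂ hκπ hπ _).1 hx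
  have hz' : p.lTensor _ z = 0 := by
    apply Module.Flat.rTensor_preserves_injective_linearMap (M := M₃) κ hκ
    rw [rTensor_lTensor_apply, hz, map_zero]
    exact (lTensor_exact P hip hp _).2 ⟨y, rfl⟩
  obtain ⟨w, rfl⟩ := (lTensor_exact _ hip hp _).1 hz'
  rw [rTensor_lTensor_apply] at hz
  have := Module.Flat.lTensor_preserves_injective_linearMap (M := P) i hi hz
  rw [← this]
  exact (rTensor_exact M₁ hκπ hπ _).2 ⟨w, rfl⟩

/-- An extension of flat modules is flat. -/
lemma flat_middle_of_exact (hi : Function.Injective i) (hip : Function.Exact i p)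
    (hp : Function.Surjective p) [Module.Flat R M₁] [Module.Flat R M₃] : Module.Flat R M₂ := by
  rw [Module.Flat.iff_rTensor_preserves_injective_linearMap]
  intro N N' _ _ _ _ f hf
  rw [injective_iff_map_eq_zero]
  intro x hx
  have h₃ : p.lTensor N x = 0 := by
    apply Module.Flat.rTensor_preserves_injective_linearMap (M := M₃) f hf
    rw [rTensor_lTensor_apply, hx, map_zero, map_zero]
  obtain ⟨y, rfl⟩ := (lTensor_exact _ hip hp _).1 h₃
  rw [rTensor_lTensor_apply] at hx
  have := lTensor_injective_of_flat_coker hi hip hp N' (hx.trans (map_zero _).symm)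
  rw [Module.Flat.rTensor_preserves_injective_linearMap (M := M₁) f hf
    (this.trans (map_zero _).symm), map_zero]

/-- The kernel of a surjection of flat modules is flat. -/
lemma flat_left_of_exact (hi : Function.Injective i) (hip : Function.Exact i p)
    (hp : Function.Surjective p) [Module.Flat R M₂] [Module.Flat R M₃] : Module.Flat R M₁ := by
  rw [Module.Flat.iff_rTensor_preserves_injective_linearMap]
  intro N N' _ _ _ _ f hf
  have h : Function.Injective ((i.lTensor N') ∘ (f.rTensor M₁)) := by
    have : (i.lTensor N') ∘ (f.rTensor M₁) = (f.rTensor M₂) ∘ (i.lTensor N) :=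
      funext fun x => (rTensor_lTensor_apply f i x).symm
    rw [this]
    exact (Module.Flat.rTensor_preserves_injective_linearMap f hf).comp
      (lTensor_injective_of_flat_coker hi hip hp N)
  exact h.of_comp

/-- The cokernel of a universally injective map to a flat module is flat. -/
lemma flat_coker_of_lTensor_injective {i : M₁ →ₗ[R] M₂} {p : M₂ →ₗ[R] M₃}
    (hip : Function.Exact i p) (hp : Function.Surjective p) [Module.Flat R M₂]
    (h : ∀ (N : Type u) [AddCommGroup N] [Module R N], Function.Injective (i.lTensor N)) :
    Module.Flat R M₃ := by
  rw [Module.Flat.iff_rTensor_preserves_injective_linearMap]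
  intro N N' _ _ _ _ f hf
  rw [injective_iff_map_eq_zero]
  intro x hx
  let q := (LinearMap.range f).mkQ
  have hq : Function.Surjective q := Submodule.mkQ_surjective _
  have hfq : Function.Exact f q := LinearMap.exact_map_mkQ_range f
  obtain ⟨y, rfl⟩ := LinearMap.lTensor_surjective N hp x
  rw [rTensor_lTensor_apply] at hx
  obtain ⟨z, hz⟩ := (lTensor_exact _ hip hp _).1 hx
  have hz' : q.rTensor _ z = 0 := by
    apply h (N' ⧸ LinearMap.range f)
    rw [← rTensor_lTensor_apply, hz, map_zero]
    exact (rTensor_exact M₂ hfq hq _).2 ⟨y, rfl⟩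
  obtain ⟨w, rfl⟩ := (rTensor_exact _ hfq hq _).1 hz'
  rw [← rTensor_lTensor_apply] at hz
  rw [← Module.Flat.rTensor_preserves_injective_linearMap (M := M₂) f hf hz]
  exact (lTensor_exact _ hip hp _).2 ⟨w, rfl⟩

end Flat

/-! ### Regular pairs and ideals of unions -/

section Ideals

open TensorProduct

universe u

variable {R A : Type u} [CommRing R] [CommRing A] [Algebra R A] {f g h : A} {I J K : Ideal A}

/-- `a` is a nonzerodivisor on `A / (f)`, expressed by elements of `A`. -/
def IsRegularMod (f a : A) : Prop := ∀ x, f ∣ a * x → f ∣ x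

/-- For a regular sequence `f, g`, also `f` is a nonzerodivisor modulo `g`. Over a ring that is not
local only this half of the permutability of regular sequences holds. -/
lemma IsRegularMod.swap (hf : f ∈ nonZeroDivisors A) (h : IsRegularMod f g) :
    IsRegularMod g f := by
  rintro x ⟨y, hy⟩
  obtain ⟨z, rfl⟩ := h y ⟨x, hy.symm⟩
  refine ⟨z, ?_⟩
  have : f * (x - g * z) = 0 := by linear_combination hy
  have := (mem_nonZeroDivisors_iff.1 hf).1 _ this
  linear_combination this

lemma IsRegularMod.mul (hg : IsRegularMod f g) (hh : IsRegularMod f h) :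
    IsRegularMod f (g * h) := fun x hx => hh x (hg _ (by rwa [← mul_assoc]))

lemma IsRegularMod.of_mul_left (h' : IsRegularMod f (g * h)) : IsRegularMod f g := fun x hx =>
  h' x (by rw [mul_right_comm]; exact hx.mul_right _)

lemma IsRegularMod.of_mul_right (hf : IsRegularMod f (g * h)) : IsRegularMod f h := fun x hx =>
  hf x (by rw [mul_assoc]; exact hx.mul_left _)

/-- Let `f, g, h` be equations of the divisors and `I, J, K` the ideals of the points of three
flags. If the divisors and the points of the union of the first two flags and of the third one have
the same intersection, then the same holds for the last two flags. -/
lemma sup_eq_span_sup_span_of_mul (hf : f ∈ I) (hg : g ∈ J) (hh : h ∈ K)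
    (hfh : IsRegularMod h f)
    (h₂ : Ideal.span {f * g} ⊔ Ideal.span {h} = (I ⊓ J) ⊔ K) :
    Ideal.span {g} ⊔ Ideal.span {h} = J ⊔ K := by
  have hle : (I ⊓ J) ⊔ K ≤ Ideal.span {f * g} ⊔ Ideal.span {h} := h₂.ge
  refine le_antisymm (sup_le_sup (by simpa [Ideal.span_le]) (by simpa [Ideal.span_le]))
    (sup_le ?_ ?_)
  · intro x hx
    have : f * x ∈ Ideal.span {f * g} ⊔ Ideal.span {h} :=
      hle (Ideal.mem_sup_left ⟨I.mul_mem_right _ hf, J.mul_mem_left _ hx⟩)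
    rw [← Ideal.span_insert, Ideal.mem_span_pair] at this ⊢
    obtain ⟨a, b, hab⟩ := this
    obtain ⟨c, hc⟩ := hfh (x - a * g) ⟨b, by linear_combination -hab⟩
    exact ⟨a, c, by linear_combination -hc⟩
  · refine (le_sup_right.trans hle).trans (sup_le_sup_right ?_ _)
    rw [Ideal.span_singleton_le_span_singleton]
    exact dvd_mul_left g f

/-- In the situation of `sup_eq_span_sup_span_of_mul`, if moreover the divisors and the points of
the first two flags have the same intersection, then the same holds for the first flag and the union
of the last two. -/
lemma span_sup_span_mul_eq (hf : f ∈ I) (hg : g ∈ J) (hh : h ∈ K)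
    (hfh : IsRegularMod h f) (hgh : IsRegularMod h g)
    (h₁ : Ideal.span {f} ⊔ Ideal.span {g} = I ⊔ J)
    (h₂ : Ideal.span {f * g} ⊔ Ideal.span {h} = (I ⊓ J) ⊔ K) :
    Ideal.span {f} ⊔ Ideal.span {g * h} = I ⊔ (J ⊓ K) := by
  rw [← Ideal.span_insert] at h₁ h₂ ⊢
  have hm : ∀ x ∈ I ⊓ J, ∃ a b, a * (f * g) + b * h = x := fun x hx =>
    Ideal.mem_span_pair.1 (h₂.ge (Ideal.mem_sup_left hx))
  have hK : ∀ x ∈ K, ∃ a b, a * (f * g) + b * h = x := fun x hx =>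
    Ideal.mem_span_pair.1 (h₂.ge (Ideal.mem_sup_right hx))
  -- a multiple of `g` in `(f * g, h)` lies in `(f, g * h)`
  have key : ∀ b, (∃ c d, c * (f * g) + d * h = g * b) → ∃ c d, c * f + d * (g * h) = g * b := by
    rintro b ⟨c, d, hcd⟩
    obtain ⟨e, he⟩ := hgh (b - c * f) ⟨d, by linear_combination -hcd⟩
    exact ⟨g * c, e, by linear_combination -g * he⟩
  refine le_antisymm ?_ (sup_le ?_ ?_)
  · rw [Ideal.span_le, Set.insert_subset_iff, Set.singleton_subset_iff]
    exact ⟨Ideal.mem_sup_left hf,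
      Ideal.mem_sup_right ⟨J.mul_mem_right _ hg, K.mul_mem_left _ hh⟩⟩
  · intro x hx
    rw [Ideal.mem_span_pair]
    obtain ⟨a, b, hab⟩ := Ideal.mem_span_pair.1 (h₁.ge (Ideal.mem_sup_left hx))
    have hgb : g * b ∈ I := by
      have := I.sub_mem hx (I.mul_mem_left a hf)
      rwa [← hab, add_sub_cancel_left, mul_comm] at this
    obtain ⟨c, d, hcd⟩ := key b (hm _ ⟨hgb, J.mul_mem_right _ hg⟩)
    exact ⟨a + c, d, by linear_combination hab + hcd⟩
  · rintro x ⟨hxJ, hxK⟩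
    rw [Ideal.mem_span_pair]
    obtain ⟨a, b, hab⟩ := Ideal.mem_span_pair.1 (h₁.ge (Ideal.mem_sup_right hxJ))
    have haf : f * a ∈ J := by
      have := J.sub_mem hxJ (J.mul_mem_left b hg)
      rwa [← hab, add_sub_cancel_right, mul_comm] at this
    obtain ⟨c, d, hcd⟩ := hm _ ⟨I.mul_mem_right _ hf, haf⟩
    -- as `f` is regular modulo `h`, the coefficient `a` lies in `(g, h)`
    obtain ⟨e, he⟩ := hfh (a - c * g) ⟨d, by linear_combination -hcd⟩
    have hK' : g * (b + c * f) ∈ K := by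
      have := K.sub_mem hxK (K.mul_mem_left (e * f) hh)
      convert this using 1
      linear_combination hab - f * he
    obtain ⟨c', d', hcd'⟩ := key _ (hK _ hK')
    exact ⟨h * e + c', d', by linear_combination hcd' + hab - f * he⟩

/-- `(f, g)` is finitely presented for a regular sequence `f, g`, by the Koszul complex. -/
lemma finitePresentation_span_sup_span (hf : f ∈ nonZeroDivisors A) (hfg : IsRegularMod f g) :
    Module.FinitePresentation A ↥(Ideal.span {f} ⊔ Ideal.span {g}) := by
  rw [← Ideal.span_insert]
  let l : A × A →ₗ[A] ↥(Ideal.span {f, g}) :=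
    LinearMap.codRestrict _ ((LinearMap.toSpanSingleton A A f).coprod
      (LinearMap.toSpanSingleton A A g)) (fun x => by
        rw [Ideal.mem_span_pair]
        exact ⟨x.1, x.2, by simp⟩)
  have hl : Function.Surjective l := by
    rintro ⟨x, hx⟩
    obtain ⟨a, b, rfl⟩ := Ideal.mem_span_pair.1 hx
    exact ⟨(a, b), Subtype.ext (by simp [l])⟩
  refine Module.finitePresentation_of_surjective l hl ?_
  suffices h : LinearMap.ker l = Submodule.span A {((g, -f) : A × A)} by
    rw [h]
    exact Submodule.fg_span_singleton _
  ext ⟨x, y⟩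
  rw [LinearMap.mem_ker, Submodule.mem_span_singleton]
  have : l (x, y) = 0 ↔ x * f + y * g = 0 := by
    rw [← Subtype.coe_inj]
    simp [l]
  rw [this]
  constructor
  · intro hxy
    obtain ⟨z, rfl⟩ := hfg y ⟨-x, by linear_combination hxy⟩
    have := (mem_nonZeroDivisors_iff.1 hf).1 (x + g * z) (by linear_combination hxy)
    refine ⟨-z, Prod.ext ?_ ?_⟩
    · simp only [Prod.smul_mk, smul_eq_mul]
      linear_combination -this
    · simp only [Prod.smul_mk, smul_eq_mul]
      ring
  · rintro ⟨z, hz⟩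
    simp only [Prod.smul_mk, smul_eq_mul, Prod.mk.injEq] at hz
    rw [← hz.1, ← hz.2]
    ring

/-- `I ∩ J` is the kernel of `I × J → I + J`. -/
lemma fg_inf_of_finitePresentation_sup (hI : I.FG) (hJ : J.FG)
    [Module.FinitePresentation A ↥(I ⊔ J)] : (I ⊓ J).FG := by
  have := Module.Finite.iff_fg.2 hI
  have := Module.Finite.iff_fg.2 hJ
  let l : I × J →ₗ[A] ↥(I ⊔ J) :=
    (Submodule.inclusion le_sup_left).coprod (-Submodule.inclusion le_sup_right)
  have hl : Function.Surjective l := by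
    rintro ⟨x, hx⟩
    obtain ⟨y, hy, z, hz, rfl⟩ := Submodule.mem_sup.1 hx
    exact ⟨(⟨y, hy⟩, -⟨z, hz⟩), Subtype.ext (by simp [l])⟩
  have := (Module.FinitePresentation.fg_ker l hl).map (I.subtype ∘ₗ LinearMap.fst A I J)
  suffices h : I ⊓ J = Submodule.map (I.subtype ∘ₗ LinearMap.fst A I J) (LinearMap.ker l) by
    rwa [h]
  ext x
  have hmem : ∀ (y : I) (z : J), l (y, z) = 0 ↔ (y : A) = z := fun y z => by
    rw [← Subtype.coe_inj]
    simp [l, ← sub_eq_add_neg, sub_eq_zero]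
  simp only [Submodule.mem_map, LinearMap.mem_ker, Prod.exists, hmem]
  constructor
  · rintro ⟨h₁, h₂⟩
    exact ⟨⟨x, h₁⟩, ⟨x, h₂⟩, rfl, rfl⟩
  · rintro ⟨y, z, hyz, rfl⟩
    exact ⟨y.2, by simp [hyz]⟩

variable (R)

lemma lsmul_mk (I : Ideal A) (a x : A) :
    Algebra.lsmul R R (A ⧸ I) a (Ideal.Quotient.mk I x) = Ideal.Quotient.mk I (a * x) := rfl

/-- The exact sequence `A / I → A / I → A / (I + (a))`. -/
lemma exact_lsmul_factor (I : Ideal A) (a : A) :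
    Function.Exact (Algebra.lsmul R R (A ⧸ I) a)
      (Ideal.Quotient.factorₐ R (le_sup_left : I ≤ I ⊔ Ideal.span {a})).toLinearMap := by
  intro x
  obtain ⟨x, rfl⟩ := Ideal.Quotient.mk_surjective x
  simp only [AlgHom.toLinearMap_apply, Ideal.Quotient.factorₐ_apply_mk, Set.mem_range,
    Ideal.Quotient.eq_zero_iff_mem, Submodule.mem_sup, Ideal.mem_span_singleton]
  constructor
  · rintro ⟨y, hy, _, ⟨z, rfl⟩, rfl⟩
    refine ⟨Ideal.Quotient.mk I z, ?_⟩
    rw [lsmul_mk, Ideal.Quotient.eq]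
    simpa using hy
  · rintro ⟨z, hz⟩
    obtain ⟨z, rfl⟩ := Ideal.Quotient.mk_surjective z
    rw [lsmul_mk, Ideal.Quotient.eq] at hz
    exact ⟨x - a * z, by simpa using I.neg_mem hz, a * z, ⟨z, rfl⟩, by ring⟩

lemma factor_sup_surjective (I J : Ideal A) :
    Function.Surjective
      (Ideal.Quotient.factorₐ R (le_sup_left : I ≤ I ⊔ J)).toLinearMap :=
  Ideal.Quotient.factor_surjective le_sup_left

/-- Multiplication by `a` is injective on `N ⊗ A / I` for all `R`-modules `N`. -/
def IsUnivRegular (I : Ideal A) (a : A) : Prop :=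
  ∀ (N : Type u) [AddCommGroup N] [Module R N],
    Function.Injective ((Algebra.lsmul R R (A ⧸ I) a).lTensor N)

variable {R}

lemma isUnivRegular_mul_iff {a b : A} :
    IsUnivRegular R I (a * b) ↔ IsUnivRegular R I a ∧ IsUnivRegular R I b := by
  have hmul : ∀ (a b : A) (N : Type u) [AddCommGroup N] [Module R N],
      ((Algebra.lsmul R R (A ⧸ I) (a * b)).lTensor N : _ → _) =
        (Algebra.lsmul R R (A ⧸ I) a).lTensor N ∘ (Algebra.lsmul R R (A ⧸ I) b).lTensor N := by
    intro a b N _ _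
    rw [map_mul, ← LinearMap.coe_comp, ← LinearMap.lTensor_comp]
    rfl
  refine ⟨fun H => ⟨fun N _ _ => ?_, fun N _ _ => ?_⟩, fun H N _ _ => ?_⟩
  · have := H N
    rw [mul_comm, hmul] at this
    exact this.of_comp
  · have := H N
    rw [hmul] at this
    exact this.of_comp
  · rw [hmul]
    exact (H.1 N).comp (H.2 N)

lemma IsUnivRegular.flat [Module.Flat R (A ⧸ I)] {a : A} (H : IsUnivRegular R I a) :
    Module.Flat R (A ⧸ I ⊔ Ideal.span {a}) :=
  flat_coker_of_lTensor_injective (exact_lsmul_factor R I a) (factor_sup_surjective R I _) H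

/-- A nonzerodivisor on `A / I` with flat cokernel is a nonzerodivisor universally. -/
lemma isUnivRegular_of_flat {a : A} (ha : ∀ x, a * x ∈ I → x ∈ I)
    (H : Module.Flat R (A ⧸ I ⊔ Ideal.span {a})) : IsUnivRegular R I a := fun N _ _ => by
  refine lTensor_injective_of_flat_coker ?_ (exact_lsmul_factor R I a)
    (factor_sup_surjective R I _) N
  rw [injective_iff_map_eq_zero]
  intro x hx
  obtain ⟨x, rfl⟩ := Ideal.Quotient.mk_surjective x
  rw [lsmul_mk, Ideal.Quotient.eq_zero_iff_mem] at hx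
  exact Ideal.Quotient.eq_zero_iff_mem.2 (ha x hx)

lemma isUnivRegular_span_of_flat (hfg : IsRegularMod f g)
    (H : Module.Flat R (A ⧸ Ideal.span {f} ⊔ Ideal.span {g})) :
    IsUnivRegular R (Ideal.span {f}) g :=
  isUnivRegular_of_flat (by simpa only [IsRegularMod, Ideal.mem_span_singleton] using hfg) H

/-- Flatness of `A / I`, `A / J` and `A / (I + J)` implies that of `A / (I ∩ J)`. -/
lemma flat_quotient_inf (hI : Module.Flat R (A ⧸ I)) (hJ : Module.Flat R (A ⧸ J))
    (hIJ : Module.Flat R (A ⧸ I ⊔ J)) : Module.Flat R (A ⧸ I ⊓ J) := by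
  let i : (A ⧸ I ⊓ J) →ₗ[R] (A ⧸ I) × (A ⧸ J) :=
    (Ideal.Quotient.factorₐ R inf_le_left).toLinearMap.prod
      (Ideal.Quotient.factorₐ R inf_le_right).toLinearMap
  let p : (A ⧸ I) × (A ⧸ J) →ₗ[R] A ⧸ I ⊔ J :=
    (Ideal.Quotient.factorₐ R le_sup_left).toLinearMap.coprod
      (-(Ideal.Quotient.factorₐ R le_sup_right).toLinearMap)
  have : Module.Flat R ((A ⧸ I) × (A ⧸ J)) :=
    flat_middle_of_exact (i := LinearMap.inl R _ _) (p := LinearMap.snd R _ _)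
      LinearMap.inl_injective .inl_snd LinearMap.snd_surjective
  refine flat_left_of_exact (i := i) (p := p) ?_ ?_ ?_
  · rw [injective_iff_map_eq_zero]
    intro x hx
    obtain ⟨x, rfl⟩ := Ideal.Quotient.mk_surjective x
    simpa [i, Ideal.Quotient.eq_zero_iff_mem] using hx
  · rintro ⟨x, y⟩
    obtain ⟨x, rfl⟩ := Ideal.Quotient.mk_surjective x
    obtain ⟨y, rfl⟩ := Ideal.Quotient.mk_surjective y
    simp only [p, i, LinearMap.coprod_apply, AlgHom.toLinearMap_apply, LinearMap.neg_apply,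
      Ideal.Quotient.factorₐ_apply_mk, ← sub_eq_add_neg, sub_eq_zero, Ideal.Quotient.eq,
      Set.mem_range]
    constructor
    · intro h
      obtain ⟨a, ha, b, hb, hab⟩ := Submodule.mem_sup.1 h
      refine ⟨Ideal.Quotient.mk _ (x - a), Prod.ext ?_ ?_⟩
      · exact Ideal.Quotient.eq.2 (by simpa using ha)
      · refine Ideal.Quotient.eq.2 ?_
        rwa [show x - a - y = b by linear_combination -hab]
    · rintro ⟨z, hz⟩
      obtain ⟨z, rfl⟩ := Ideal.Quotient.mk_surjective z
      have h₁ := Ideal.Quotient.eq.1 (congr_arg Prod.fst hz)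
      have h₂ := Ideal.Quotient.eq.1 (congr_arg Prod.snd hz)
      have := (I ⊔ J).sub_mem (Ideal.mem_sup_right h₂) (Ideal.mem_sup_left h₁)
      simpa using this
  · intro x
    obtain ⟨x, rfl⟩ := Ideal.Quotient.mk_surjective x
    exact ⟨(Ideal.Quotient.mk _ x, 0), by simp [p]⟩

/-- The sum of two relative effective Cartier divisors is flat. -/
lemma flat_quotient_span_mul (hf : f ∈ nonZeroDivisors A) (h₁ : Module.Flat R (A ⧸ Ideal.span {f}))
    (h₂ : Module.Flat R (A ⧸ Ideal.span {g})) : Module.Flat R (A ⧸ Ideal.span {f * g}) := by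
  have hle : Ideal.span {f * g} ≤ Ideal.span {f} :=
    Ideal.span_singleton_le_span_singleton.2 (dvd_mul_right f g)
  let i : (A ⧸ Ideal.span {g}) →ₗ[A] A ⧸ Ideal.span {f * g} :=
    Submodule.mapQ _ _ (LinearMap.lsmul A A f) (by
      rw [Ideal.span_le, Set.singleton_subset_iff]
      exact Ideal.mem_span_singleton_self (f * g))
  -- the exact sequence `0 → A / g → A / fg → A / f → 0`
  refine flat_middle_of_exact (i := i.restrictScalars R)
    (p := (Ideal.Quotient.factorₐ R hle).toLinearMap) ?_ ?_ (Ideal.Quotient.factor_surjective hle)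
  · rw [injective_iff_map_eq_zero]
    intro x hx
    obtain ⟨x, rfl⟩ := Ideal.Quotient.mk_surjective x
    have hx : f * x ∈ Ideal.span {f * g} := Ideal.Quotient.eq_zero_iff_mem.1 hx
    obtain ⟨z, hz⟩ := Ideal.mem_span_singleton.1 hx
    refine Ideal.Quotient.eq_zero_iff_mem.2 (Ideal.mem_span_singleton.2 ⟨z, ?_⟩)
    have := (mem_nonZeroDivisors_iff.1 hf).1 (x - g * z) (by linear_combination hz)
    linear_combination this
  · intro x
    obtain ⟨x, rfl⟩ := Ideal.Quotient.mk_surjective x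
    simp only [AlgHom.toLinearMap_apply, Ideal.Quotient.factorₐ_apply_mk, Set.mem_range,
      Ideal.Quotient.eq_zero_iff_mem, Ideal.mem_span_singleton]
    constructor
    · rintro ⟨y, rfl⟩
      exact ⟨Ideal.Quotient.mk _ y, rfl⟩
    · rintro ⟨y, hy⟩
      obtain ⟨y, rfl⟩ := Ideal.Quotient.mk_surjective y
      have hy : f * y - x ∈ Ideal.span {f * g} := Ideal.Quotient.eq.1 hy
      obtain ⟨z, hz⟩ := Ideal.mem_span_singleton.1 hy
      exact ⟨y - g * z, by linear_combination -hz⟩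

/-- A product is universally regular on `A / (h)` iff both factors are, hence the flatness of
`A / (h, f * g)` passes to `A / (h, f)` and `A / (h, g)`. -/
lemma flat_of_flat_mul (hh : Module.Flat R (A ⧸ Ideal.span {h}))
    (hfg : IsRegularMod h (f * g))
    (H : Module.Flat R (A ⧸ Ideal.span {h} ⊔ Ideal.span {f * g})) :
    Module.Flat R (A ⧸ Ideal.span {h} ⊔ Ideal.span {f}) ∧
      Module.Flat R (A ⧸ Ideal.span {h} ⊔ Ideal.span {g}) :=
  have := isUnivRegular_mul_iff.1 (isUnivRegular_span_of_flat hfg H)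
  ⟨this.1.flat, this.2.flat⟩

lemma flat_mul_of_flat (hh : Module.Flat R (A ⧸ Ideal.span {h}))
    (hf : IsRegularMod h f) (hg : IsRegularMod h g)
    (hf' : Module.Flat R (A ⧸ Ideal.span {h} ⊔ Ideal.span {f}))
    (hg' : Module.Flat R (A ⧸ Ideal.span {h} ⊔ Ideal.span {g})) :
    Module.Flat R (A ⧸ Ideal.span {h} ⊔ Ideal.span {f * g}) :=
  (isUnivRegular_mul_iff.2 ⟨isUnivRegular_span_of_flat hf hf',
    isUnivRegular_span_of_flat hg hg'⟩).flat

end Ideals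

/-! ### Base change of regular pairs and of intersections of ideals -/

section BaseChange

open TensorProduct

universe u

variable {R A : Type u} [CommRing R] [CommRing A] [Algebra R A] {f g h : A} {I J K : Ideal A}
variable (R' : Type u) [CommRing R'] [Algebra R R']

lemma lTensor_lsmul (a : A) (x : R' ⊗[R] A) :
    (Algebra.lsmul R R A a).lTensor R' x = (1 ⊗ₜ a) * x := by
  induction x with
  | zero => simp
  | tmul r b => simp
  | add x y hx hy => rw [map_add, hx, hy, mul_add]

lemma isRegularMod_tmul
    (H : Function.Injective ((Algebra.lsmul R R (A ⧸ Ideal.span {f}) g).lTensor R')) :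
    IsRegularMod ((1 : R') ⊗ₜ[R] f) (1 ⊗ₜ g) := by
  let q : A →ₗ[R] A ⧸ Ideal.span {f} := (Ideal.Quotient.mkₐ R _).toLinearMap
  have hq : Function.Surjective q := Ideal.Quotient.mk_surjective
  have hfq : Function.Exact (Algebra.lsmul R R A f) q := by
    intro x
    refine Ideal.Quotient.eq_zero_iff_mem.trans (Ideal.mem_span_singleton.trans ?_)
    exact ⟨fun ⟨y, hy⟩ => ⟨y, hy.symm⟩, fun ⟨y, hy⟩ => ⟨y, hy.symm⟩⟩
  have hex := lTensor_exact R' hfq hq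
  have hcomm : ∀ x : R' ⊗[R] A, q.lTensor R' ((1 ⊗ₜ g) * x) =
      (Algebra.lsmul R R (A ⧸ Ideal.span {f}) g).lTensor R' (q.lTensor R' x) := by
    intro x
    rw [← lTensor_lsmul, ← LinearMap.comp_apply, ← LinearMap.comp_apply, ← LinearMap.lTensor_comp,
      ← LinearMap.lTensor_comp]
    rfl
  rintro x ⟨y, hy⟩
  have hx : q.lTensor R' x = 0 := by
    apply H
    rw [← hcomm, hy, map_zero, ← lTensor_lsmul]
    exact (hex _).2 ⟨y, rfl⟩
  obtain ⟨z, rfl⟩ := (hex _).1 hx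
  exact ⟨z, lTensor_lsmul R' f z⟩

/-- Intersections of ideals commute with base change if `A / (I + J)` is flat: then
`R' ⊗ (I + J) → R' ⊗ A` is injective, and the base change of `I ∩ J` can be computed from the exact
sequence `I ∩ J → I × J → I + J`. -/
lemma map_includeRight_inf (H : Module.Flat R (A ⧸ I ⊔ J)) :
    (I ⊓ J).map (Algebra.TensorProduct.includeRight : A →ₐ[R] R' ⊗[R] A) =
      I.map (Algebra.TensorProduct.includeRight : A →ₐ[R] R' ⊗[R] A) ⊓
        J.map (Algebra.TensorProduct.includeRight : A →ₐ[R] R' ⊗[R] A) := by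
  refine le_antisymm (Ideal.map_inf_le _) fun x ⟨hxI, hxJ⟩ => ?_
  have hmem : ∀ (L : Ideal A) (x : R' ⊗[R] A),
      x ∈ L.map (Algebra.TensorProduct.includeRight : A →ₐ[R] R' ⊗[R] A) ↔
      ∃ y, (L.subtype.restrictScalars R).lTensor R' y = x := fun L x =>
    (SetLike.ext_iff.1 (Ideal.map_includeRight_eq (R := R) (A := R') L) x)
  obtain ⟨u, hu⟩ := (hmem I x).1 hxI
  obtain ⟨v, hv⟩ := (hmem J x).1 hxJ
  let i : ↥(I ⊓ J) →ₗ[R] I × J :=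
    ((Submodule.inclusion inf_le_left).prod (Submodule.inclusion inf_le_right)).restrictScalars R
  let p : I × J →ₗ[R] ↥(I ⊔ J) :=
    ((Submodule.inclusion le_sup_left).coprod
      (-Submodule.inclusion le_sup_right)).restrictScalars R
  have hp : Function.Surjective p := by
    rintro ⟨x, hx⟩
    obtain ⟨y, hy, z, hz, rfl⟩ := Submodule.mem_sup.1 hx
    exact ⟨(⟨y, hy⟩, -⟨z, hz⟩), Subtype.ext (by simp [p])⟩
  have hip : Function.Exact i p := by
    rintro ⟨y, z⟩
    rw [← Subtype.coe_inj]
    simp only [LinearMap.coe_restrictScalars, LinearMap.coprod_apply, LinearMap.neg_apply,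
      ← sub_eq_add_neg, p, Submodule.coe_sub, Submodule.coe_inclusion, Submodule.coe_zero,
      sub_eq_zero, Set.mem_range]
    constructor
    · intro h
      exact ⟨⟨y, y.2, h ▸ z.2⟩, Prod.ext rfl (Subtype.ext h)⟩
    · rintro ⟨w, hw⟩
      exact (congr_arg (fun q => (q.1 : A)) hw).symm.trans (congr_arg (fun q => (q.2 : A)) hw)
  have hinj : Function.Injective (((I ⊔ J).subtype.restrictScalars R).lTensor R') :=
    lTensor_injective_of_flat_coker (p := (Ideal.Quotient.mkₐ R (I ⊔ J)).toLinearMap)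
      Subtype.val_injective (fun x => by
        refine Ideal.Quotient.eq_zero_iff_mem.trans ?_
        exact ⟨fun h => ⟨⟨x, h⟩, rfl⟩, fun ⟨y, hy⟩ => hy ▸ y.2⟩)
      Ideal.Quotient.mk_surjective R'
  have hcompl : (I ⊔ J).subtype.restrictScalars R ∘ₗ p ∘ₗ LinearMap.inl R I J =
      I.subtype.restrictScalars R := by ext; simp [p]
  have hcompr : (I ⊔ J).subtype.restrictScalars R ∘ₗ p ∘ₗ LinearMap.inr R I J =
      -J.subtype.restrictScalars R := by ext; simp [p]
  let w := (LinearMap.inl R I J).lTensor R' u + (LinearMap.inr R I J).lTensor R' v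
  have hw : p.lTensor R' w = 0 := by
    apply hinj
    rw [map_zero, map_add, map_add]
    simp only [← LinearMap.comp_apply, ← LinearMap.lTensor_comp]
    rw [hcompl, hcompr, LinearMap.lTensor_neg, LinearMap.neg_apply, hu, hv, add_neg_cancel]
  obtain ⟨t, ht⟩ := (lTensor_exact R' hip hp _).1 hw
  rw [hmem]
  refine ⟨t, ?_⟩
  have h₁ : LinearMap.fst R I J ∘ₗ i = (Submodule.inclusion inf_le_left).restrictScalars R := rfl
  have h₂ : (I ⊓ J).subtype.restrictScalars R =
      I.subtype.restrictScalars R ∘ₗ LinearMap.fst R I J ∘ₗ i := rfl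
  rw [h₂, LinearMap.lTensor_comp, LinearMap.lTensor_comp, LinearMap.comp_apply,
    LinearMap.comp_apply, ht, map_add]
  have h₃ : (LinearMap.fst R I J).lTensor R' ((LinearMap.inl R I J).lTensor R' u) = u := by
    rw [← LinearMap.comp_apply, ← LinearMap.lTensor_comp, LinearMap.fst_comp_inl]
    simp
  have h₄ : (LinearMap.fst R I J).lTensor R' ((LinearMap.inr R I J).lTensor R' v) = 0 := by
    rw [← LinearMap.comp_apply, ← LinearMap.lTensor_comp, LinearMap.fst_comp_inr]
    simp
  rw [h₃, h₄, add_zero, hu]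

variable {R'} {A' : Type u} [CommRing A'] [Algebra R A'] [Algebra R' A'] [Algebra A A']
  [IsScalarTower R R' A'] [IsScalarTower R A A']

variable (R' A') in
lemma isPushout_equiv_comp_includeRight [Algebra.IsPushout R R' A A'] :
    ((Algebra.IsPushout.equiv R R' A A').toRingEquiv : R' ⊗[R] A →+* A').comp
      ((Algebra.TensorProduct.includeRight : A →ₐ[R] R' ⊗[R] A) : A →+* R' ⊗[R] A) =
      algebraMap A A' := by
  ext x
  simp [Algebra.IsPushout.equiv_tmul]

variable (R' A') in
/-- `isRegularMod_tmul` for an arbitrary model `A'` of the base change. -/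
lemma isRegularMod_algebraMap [Algebra.IsPushout R R' A A']
    (H : Function.Injective ((Algebra.lsmul R R (A ⧸ Ideal.span {f}) g).lTensor R')) :
    IsRegularMod (algebraMap A A' f) (algebraMap A A' g) := by
  intro x hx
  let e := Algebra.IsPushout.equiv R R' A A'
  have he : ∀ a, e.symm (algebraMap A A' a) = 1 ⊗ₜ a :=
    Algebra.IsPushout.equiv_symm_algebraMap_right R R' A A'
  have h := isRegularMod_tmul R' H (e.symm x)
    (by rw [← he, ← he, ← map_mul]; exact map_dvd e.symm hx)
  rw [← he] at h
  simpa using map_dvd e h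

variable (R' A') in
/-- `map_includeRight_inf` for an arbitrary model `A'` of the base change. -/
lemma map_algebraMap_inf [Algebra.IsPushout R R' A A']
    (H : Module.Flat R (A ⧸ I ⊔ J)) :
    (I ⊓ J).map (algebraMap A A') = I.map (algebraMap A A') ⊓ J.map (algebraMap A A') := by
  have hmap : ∀ X Y : Ideal (R' ⊗[R] A),
      (X ⊓ Y).map ((Algebra.IsPushout.equiv R R' A A').toRingEquiv : R' ⊗[R] A →+* A') =
      X.map ((Algebra.IsPushout.equiv R R' A A').toRingEquiv : R' ⊗[R] A →+* A') ⊓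
        Y.map ((Algebra.IsPushout.equiv R R' A A').toRingEquiv : R' ⊗[R] A →+* A') := by
    intro X Y
    rw [Ideal.map_comap_of_equiv, Ideal.map_comap_of_equiv, Ideal.map_comap_of_equiv,
      Ideal.comap_inf]
  have h := fun L : Ideal A => Ideal.map_map (I := L)
    ((Algebra.TensorProduct.includeRight : A →ₐ[R] R' ⊗[R] A) : A →+* R' ⊗[R] A)
    ((Algebra.IsPushout.equiv R R' A A').toRingEquiv : R' ⊗[R] A →+* A')
  rw [isPushout_equiv_comp_includeRight] at h
  rw [← h, ← h, ← h, ← hmap]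
  exact congr_arg _ (map_includeRight_inf R' H)

lemma isRegularMod_zero_iff : IsRegularMod 0 f ↔ f ∈ nonZeroDivisors A := by
  simp only [IsRegularMod, zero_dvd_iff, mem_nonZeroDivisors_iff_right, mul_comm f]

lemma IsRegularMod.map_of_flat {B : Type u} [CommRing B] {φ : A →+* B} (hφ : φ.Flat)
    (H : IsRegularMod f g) : IsRegularMod (φ f) (φ g) := by
  algebraize [φ]
  refine isRegularMod_algebraMap (R := A) (R' := B) (A := A) (A' := B)
    (Module.Flat.lTensor_preserves_injective_linearMap _ ?_)
  rw [injective_iff_map_eq_zero]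
  intro x hx
  obtain ⟨x, rfl⟩ := Ideal.Quotient.mk_surjective x
  rw [lsmul_mk, Ideal.Quotient.eq_zero_iff_mem, Ideal.mem_span_singleton] at hx
  rw [Ideal.Quotient.eq_zero_iff_mem, Ideal.mem_span_singleton]
  exact H x hx

/-- Regularity modulo a principal ideal only depends on the ideals and not on the generators. -/
lemma IsRegularMod.congr {f' g' : A} (H : IsRegularMod f g)
    (hf : Ideal.span {f} = Ideal.span {f'}) (hg : Ideal.span {g} = Ideal.span {g'}) :
    IsRegularMod f' g' := by
  have h₁ : f ∣ f' := Ideal.span_singleton_le_span_singleton.1 hf.ge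
  have h₂ : f' ∣ f := Ideal.span_singleton_le_span_singleton.1 hf.le
  obtain ⟨a, rfl⟩ : g' ∣ g := Ideal.span_singleton_le_span_singleton.1 hg.le
  intro x hx
  refine h₂.trans (H x (h₁.trans ?_))
  rw [mul_right_comm]
  exact hx.mul_right a

end BaseChange

/-! ### Ideal sheaves on affine opens -/

section Sheaves

variable {X Y S : Scheme.{0}}

/-- The kernel of a cobase change of a surjection is the extension of its kernel. -/
lemma ker_of_isPushout {A B C P : CommRingCat.{0}} {c : A ⟶ C} {b : A ⟶ B} {i : C ⟶ P} {j : B ⟶ P}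
    (H : IsPushout c b i j) (hc : Function.Surjective c.hom) :
    RingHom.ker j.hom = (RingHom.ker c.hom).map b.hom := by
  refine le_antisymm (fun x hx => ?_) ?_
  · let K : Ideal B := (RingHom.ker c.hom).map b.hom
    let q : B →+* B ⧸ K := Ideal.Quotient.mk K
    let l : C →+* B ⧸ K := RingHom.liftOfSurjective c.hom hc
      ⟨q.comp b.hom, fun x hx => Ideal.Quotient.eq_zero_iff_mem.2 (Ideal.mem_map_of_mem _ hx)⟩
    have hl : l.comp c.hom = q.comp b.hom := by
      exact RingHom.liftOfSurjective_comp _ _ _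
    have hw : c ≫ CommRingCat.ofHom l = b ≫ CommRingCat.ofHom q := CommRingCat.hom_ext hl
    have := H.inr_desc _ _ hw
    refine (Ideal.Quotient.eq_zero_iff_mem (I := K)).1 ?_
    change (CommRingCat.ofHom q).hom x = 0
    rw [← this, CommRingCat.hom_comp, RingHom.comp_apply, RingHom.mem_ker.1 hx, map_zero]
  · rw [Ideal.map_le_iff_le_comap]
    intro x hx
    have := congr_arg (fun φ => φ.hom x) H.w
    simp only [CommRingCat.hom_comp, RingHom.comp_apply] at this
    rw [Ideal.mem_comap, RingHom.mem_ker, ← this, RingHom.mem_ker.1 hx, map_zero]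

/-- The inverse image ideal sheaf is generated, on affine opens, by the inverse images of sections
of the ideal. -/
lemma ideal_comap (I : Y.IdealSheafData) (f : X ⟶ Y) (U : Y.affineOpens) (V : X.affineOpens)
    (e : V.1 ≤ f ⁻¹ᵁ U.1) :
    (I.comap f).ideal V = (I.ideal U).map (f.appLE U V e).hom := by
  have hP := IsPullback.of_hasPullback f I.subschemeι
  have haff : IsAffineOpen (I.subschemeι ⁻¹ᵁ U.1) := U.2.preimage _
  have hUY : pullback.fst f I.subschemeι ⁻¹ᵁ V.1 =
      pullback.snd f I.subschemeι ⁻¹ᵁ (I.subschemeι ⁻¹ᵁ U.1) ⊓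
        pullback.fst f I.subschemeι ⁻¹ᵁ V.1 := by
    rw [right_eq_inf, ← Scheme.Hom.comp_preimage, ← pullback.condition, Scheme.Hom.comp_preimage]
    exact fun x hx => e hx
  have h := (isIso_pushoutSection_iff hP.flip (US := U.1) (UT := V.1)
    (UX := I.subschemeι ⁻¹ᵁ U.1) e le_rfl hUY).1
      (isIso_pushoutSection_of_isAffineOpen hP.flip e le_rfl hUY U.2 V.2 haff)
  have h' := ker_of_isPushout h (by
    rw [← Scheme.Hom.app_eq_appLE]
    exact I.subschemeι_app_surjective U)
  rw [Scheme.IdealSheafData.comap, Scheme.Hom.ker_apply, Scheme.Hom.app_eq_appLE, h',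
    ← Scheme.Hom.app_eq_appLE, I.ker_subschemeι_app]

lemma exists_affineOpens_le (y : Y) (W : Y.Opens) (hy : y ∈ W) :
    ∃ U : Y.affineOpens, y ∈ U.1 ∧ U.1 ≤ W := by
  obtain ⟨_, ⟨U, hU, rfl⟩, hyU, hle⟩ := Y.isBasis_affineOpens.exists_subset_of_mem_open hy W.2
  exact ⟨⟨U, hU⟩, hyU, hle⟩

/-- A local property of morphisms holds for a closed subscheme of `Y`, as a scheme over the affine
scheme `S`, iff it holds for the maps `Γ(S) → Γ(U) / I(U)` with `U` in an affine cover of `Y`. -/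
lemma subscheme_iff {P : MorphismProperty Scheme.{0}}
    {Q : ∀ {R A : Type} [CommRing R] [CommRing A], (R →+* A) → Prop} [HasRingHomProperty P Q]
    [IsAffine S] (p : Y ⟶ S) (I : Y.IdealSheafData) {ι : Type*} (U : ι → Y.affineOpens)
    (hU : ∀ y, ∃ i, y ∈ (U i).1) :
    P (I.subschemeι ≫ p) ↔
      ∀ i, Q ((Ideal.Quotient.mk (I.ideal (U i))).comp (p.appLE ⊤ (U i).1 le_top).hom) := by
  rw [HasRingHomProperty.iff_of_iSup_eq_top (P := P)
    (fun i => ⟨I.subschemeι ⁻¹ᵁ (U i).1, (U i).2.preimage _⟩)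
    (by
      rw [← Scheme.Hom.preimage_iSup]
      convert Scheme.Hom.preimage_top _
      ext y
      simpa using hU y)]
  refine forall_congr' fun i => ?_
  have h : (I.subschemeι ≫ p).appLE ⊤ (I.subschemeι ⁻¹ᵁ (U i).1) le_top =
      (p.appLE ⊤ (U i).1 le_top ≫ CommRingCat.ofHom (Ideal.Quotient.mk (I.ideal (U i)))) ≫
        (I.subschemeObjIso (U i)).inv := by
    rw [Category.assoc, ← I.subschemeι_app, Scheme.Hom.app_eq_appLE]
    exact (Scheme.Hom.appLE_comp_appLE ..).symm
  rw [h, CommRingCat.hom_comp,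
    (HasRingHomProperty.isLocal_ringHomProperty P).respectsIso.cancel_right_isIso]
  rfl

lemma flat_restriction {U V : Y.affineOpens} (h : U ≤ V) :
    (Y.presheaf.map (homOfLE (show U.1 ≤ V.1 from h)).op).hom.Flat := by
  have := HasRingHomProperty.appLE @Flat (𝟙 Y) inferInstance V U h
  rwa [show (𝟙 Y : Y ⟶ Y).appLE V.1 U.1 h = Y.presheaf.map (homOfLE (show U.1 ≤ V.1 from h)).op
    from Category.id_comp _] at this

lemma ideal_eq_span_of_le (I : Y.IdealSheafData) {U V : Y.affineOpens} (h : U ≤ V)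
    {f : Γ(Y, V)} (hf : I.ideal V = Ideal.span {f}) :
    I.ideal U = Ideal.span {(Y.presheaf.map (homOfLE (show U.1 ≤ V.1 from h)).op).hom f} := by
  rw [← I.map_ideal h, hf, Ideal.map_span, Set.image_singleton]
  rfl

/-- The ideal of `D` on the affine open `U` is generated by one nonzerodivisor. -/
def IsCartierOn (D : Y.IdealSheafData) (U : Y.affineOpens) : Prop :=
  ∃ f ∈ nonZeroDivisors Γ(Y, U), D.ideal U = Ideal.span {f}

/-- The ideals of `D` and `E` on the affine open `U` are generated by nonzerodivisors `f` and `g`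
which form a regular sequence. -/
def IsRegularOn (D E : Y.IdealSheafData) (U : Y.affineOpens) : Prop :=
  ∃ f ∈ nonZeroDivisors Γ(Y, U), ∃ g ∈ nonZeroDivisors Γ(Y, U),
    D.ideal U = Ideal.span {f} ∧ E.ideal U = Ideal.span {g} ∧ IsRegularMod f g

lemma mem_nonZeroDivisors_restriction {U V : Y.affineOpens} (h : U ≤ V) {f : Γ(Y, V)}
    (hf : f ∈ nonZeroDivisors Γ(Y, V)) :
    (Y.presheaf.map (homOfLE (show U.1 ≤ V.1 from h)).op).hom f ∈ nonZeroDivisors Γ(Y, U) := by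
  rw [← isRegularMod_zero_iff] at hf ⊢
  simpa using hf.map_of_flat (flat_restriction h)

lemma IsCartierOn.mono {D : Y.IdealSheafData} {U V : Y.affineOpens} (h : U ≤ V)
    (H : IsCartierOn D V) : IsCartierOn D U :=
  let ⟨_, hf, hD⟩ := H
  ⟨_, mem_nonZeroDivisors_restriction h hf, ideal_eq_span_of_le D h hD⟩

lemma IsRegularOn.mono {D E : Y.IdealSheafData} {U V : Y.affineOpens} (h : U ≤ V)
    (H : IsRegularOn D E V) : IsRegularOn D E U :=
  let ⟨_, hf, _, hg, hD, hE, hfg⟩ := H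
  ⟨_, mem_nonZeroDivisors_restriction h hf, _, mem_nonZeroDivisors_restriction h hg,
    ideal_eq_span_of_le D h hD, ideal_eq_span_of_le E h hE, hfg.map_of_flat (flat_restriction h)⟩

lemma IsRegularOn.symm {D E : Y.IdealSheafData} {U : Y.affineOpens} (H : IsRegularOn D E U) :
    IsRegularOn E D U :=
  let ⟨f, hf, g, hg, hD, hE, hfg⟩ := H
  ⟨g, hg, f, hf, hE, hD, hfg.swap hf⟩

/-- Two properties of affine opens that pass to smaller ones and hold locally hold locally at the
same time. -/
lemma locally_and {P Q : Y.affineOpens → Prop} (hP : ∀ {U V}, U ≤ V → P V → P U)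
    (hQ : ∀ {U V}, U ≤ V → Q V → Q U) (h₁ : ∀ y, ∃ U : Y.affineOpens, y ∈ U.1 ∧ P U)
    (h₂ : ∀ y, ∃ U : Y.affineOpens, y ∈ U.1 ∧ Q U) (y : Y) :
    ∃ U : Y.affineOpens, y ∈ U.1 ∧ P U ∧ Q U := by
  obtain ⟨U, hyU, hU⟩ := h₁ y
  obtain ⟨V, hyV, hV⟩ := h₂ y
  obtain ⟨W, hyW, hW⟩ := exists_affineOpens_le y (U.1 ⊓ V.1) ⟨hyU, hyV⟩
  exact ⟨W, hyW, hP (hW.trans inf_le_left) hU, hQ (hW.trans inf_le_right) hV⟩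

end Sheaves

/-! ### Divisors in good position -/

section Divisors

variable {X Y S : Scheme.{0}}

/-- The restriction of `E` to `D` is an effective Cartier divisor iff local equations of `D` and
`E` form regular sequences. -/
lemma isEffectiveCartier_comap_subschemeι_iff {D E : Y.IdealSheafData} (hD : IsEffectiveCartier D)
    (hE : IsEffectiveCartier E) :
    IsEffectiveCartier (E.comap D.subschemeι) ↔
      ∀ y, ∃ U : Y.affineOpens, y ∈ U.1 ∧ IsRegularOn D E U := by
  -- sections of `D` on `U` are `Γ(U) / (f)`
  have key : ∀ (U : Y.affineOpens) (f g : Γ(Y, U)), D.ideal U = Ideal.span {f} →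
      (IsRegularMod f g ↔ (D.subschemeι.app U.1).hom g ∈
        nonZeroDivisors Γ(D.subscheme, D.subschemeι ⁻¹ᵁ U.1)) := by
    intro U f g hf
    have hk : ∀ a, (D.subschemeι.app U.1).hom a = 0 ↔ f ∣ a := fun a => by
      rw [← RingHom.mem_ker, D.ker_subschemeι_app, hf, Ideal.mem_span_singleton]
    rw [mem_nonZeroDivisors_iff_right]
    constructor
    · intro H x hx
      obtain ⟨x, rfl⟩ := D.subschemeι_app_surjective U x
      rw [mul_comm, ← map_mul] at hx
      exact (hk x).2 (H x ((hk _).1 hx))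
    · intro H x hx
      refine (hk x).1 (H _ ?_)
      rw [mul_comm, ← map_mul]
      exact (hk _).2 hx
  have hcart : ∀ (y : Y) (W : Y.Opens), y ∈ W → ∃ U : Y.affineOpens, y ∈ U.1 ∧ U.1 ≤ W ∧
      IsCartierOn D U ∧ IsCartierOn E U := by
    intro y W hy
    obtain ⟨V, hyV, hV⟩ := locally_and IsCartierOn.mono IsCartierOn.mono hD hE y
    obtain ⟨U, hyU, hU⟩ := exists_affineOpens_le y (V.1 ⊓ W) ⟨hyV, hy⟩
    exact ⟨U, hyU, hU.trans inf_le_right, hV.1.mono (hU.trans inf_le_left),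
      hV.2.mono (hU.trans inf_le_left)⟩
  have hcomap : ∀ (U : Y.affineOpens) (g : Γ(Y, U)), E.ideal U = Ideal.span {g} →
      (E.comap D.subschemeι).ideal ⟨D.subschemeι ⁻¹ᵁ U.1, U.2.preimage _⟩ =
        Ideal.span {(D.subschemeι.app U.1).hom g} := by
    intro U g hg
    rw [ideal_comap E D.subschemeι U _ le_rfl, hg, Ideal.map_span, Set.image_singleton,
      Scheme.Hom.app_eq_appLE]
  constructor
  · intro H y
    by_cases hy : y ∈ D.support
    · obtain ⟨y, rfl⟩ : y ∈ Set.range D.subschemeι := by rwa [D.range_subschemeι]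
      obtain ⟨V, hyV, a, ha, hV⟩ := H y
      obtain ⟨W, hW⟩ : ∃ W : Y.Opens, D.subschemeι ⁻¹ᵁ W = V.1 := by
        obtain ⟨W, hWo, hW⟩ := D.subschemeι.isEmbedding.isInducing.isOpen_iff.1 V.1.2
        exact ⟨⟨W, hWo⟩, TopologicalSpace.Opens.ext hW⟩
      obtain ⟨U, hyU, hUW, ⟨f, hf, hDU⟩, ⟨g, hg, hEU⟩⟩ :=
        hcart (D.subschemeι y) W (by rw [← hW] at hyV; exact hyV)
      refine ⟨U, hyU, f, hf, g, hg, hDU, hEU, (key U f g hDU).2 ?_⟩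
      let U' : D.subscheme.affineOpens := ⟨D.subschemeι ⁻¹ᵁ U.1, U.2.preimage _⟩
      have hle : U' ≤ V := by
        change D.subschemeι ⁻¹ᵁ U.1 ≤ V.1
        rw [← hW]
        exact fun x hx => hUW hx
      have h₁ := ideal_eq_span_of_le _ hle hV
      have h₂ := mem_nonZeroDivisors_restriction hle ha
      rw [hcomap U g hEU] at h₁
      rw [← isRegularMod_zero_iff] at h₂ ⊢
      exact h₂.congr rfl h₁.symm
    · obtain ⟨U, hyU, hUW, ⟨f, hf, hDU⟩, ⟨g, hg, hEU⟩⟩ :=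
        hcart y ⟨(D.support : Set Y)ᶜ, D.support.isClosed.isOpen_compl⟩ hy
      -- away from `D`, the equation of `D` is a unit
      have hempty : D.subschemeι ⁻¹ᵁ U.1 = ⊥ := by
        ext x
        simp only [TopologicalSpace.Opens.coe_bot, Set.mem_empty_iff_false, iff_false]
        exact fun hx => hUW hx (D.range_subschemeι.le ⟨x, rfl⟩)
      refine ⟨U, hyU, f, hf, g, hg, hDU, hEU, (key U f g hDU).2 ?_⟩
      have : Subsingleton Γ(D.subscheme, D.subschemeι ⁻¹ᵁ U.1) := by
        rw [hempty]
        infer_instance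
      rw [mem_nonZeroDivisors_iff_right]
      exact fun x _ => Subsingleton.elim _ _
  · intro H y
    obtain ⟨U, hyU, f, hf, g, hg, hDU, hEU, hfg⟩ := H (D.subschemeι y)
    exact ⟨⟨D.subschemeι ⁻¹ᵁ U.1, U.2.preimage _⟩, hyU, _, (key U f g hDU).1 hfg, hcomap U g hEU⟩

/-- `D ∩ E`, as a subscheme of `D`, is the subscheme `D ∩ E` of `Y`. -/
lemma flat_comap_subschemeι_iff (p : Y ⟶ S) (D E : Y.IdealSheafData) :
    Flat ((E.comap D.subschemeι).subschemeι ≫ D.subschemeι ≫ p) ↔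
      Flat ((D ⊔ E).subschemeι ≫ p) := by
  have hker : ((E.comap D.subschemeι).subschemeι ≫ D.subschemeι).ker = D ⊔ E := by
    ext U : 2
    rw [Scheme.IdealSheafData.ideal_sup]
    change ((E.comap D.subschemeι).map D.subschemeι).ideal U = _
    rw [Scheme.IdealSheafData.ideal_map_of_isAffineHom, ideal_comap E D.subschemeι U _ le_rfl,
      ← Scheme.Hom.app_eq_appLE, Ideal.comap_map_of_surjective _ (D.subschemeι_app_surjective U),
      ← RingHom.ker_eq_comap_bot, D.ker_subschemeι_app]
    exact sup_comm _ _
  let i := (E.comap D.subschemeι).subschemeι ≫ D.subschemeι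
  have : IsIso i.toImage := inferInstance
  have h : i ≫ p = i.toImage ≫ i.imageι ≫ p := by rw [Scheme.Hom.toImage_imageι_assoc]
  rw [← Category.assoc]
  change Flat (i ≫ p) ↔ _
  have hflat : Flat (i ≫ p) ↔ Flat (i.imageι ≫ p) := by
    rw [h]
    refine ⟨fun H => ?_, fun H => inferInstance⟩
    rw [← IsIso.inv_hom_id_assoc i.toImage (i.imageι ≫ p)]
    infer_instance
  rw [hflat, Scheme.Hom.imageι, ← hker]

lemma isGoodDivisors_iff (p : Y ⟶ S) {D E : Y.IdealSheafData} (hD : IsEffectiveCartier D)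
    (hE : IsEffectiveCartier E) :
    IsGoodDivisors p D E ↔ (∀ y, ∃ U : Y.affineOpens, y ∈ U.1 ∧ IsRegularOn D E U) ∧
      Flat ((D ⊔ E).subschemeι ≫ p) := by
  rw [← isEffectiveCartier_comap_subschemeι_iff hD hE, ← flat_comap_subschemeι_iff]
  refine ⟨fun H => ⟨H.left.cartier, H.left.flat⟩, fun H => ⟨⟨H.1, H.2⟩, ⟨?_, ?_⟩⟩⟩
  · rw [isEffectiveCartier_comap_subschemeι_iff hE hD]
    intro y
    obtain ⟨U, hyU, hU⟩ := (isEffectiveCartier_comap_subschemeι_iff hD hE).1 H.1 y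
    exact ⟨U, hyU, hU.symm⟩
  · rw [flat_comap_subschemeι_iff, sup_comm, ← flat_comap_subschemeι_iff]
    exact H.2

end Divisors

/-! ### Unions of good pairs of flags -/

section Finite

variable {X Y S : Scheme.{0}}

/-- A separated scheme of finite type dominated by a finite scheme is finite. -/
lemma isFinite_of_surjective (f : X ⟶ Y) (g : Y ⟶ S) [Surjective f] [IsFinite (f ≫ g)]
    [IsSeparated g] [LocallyOfFiniteType g] : IsFinite g := by
  have : UniversallyClosed g := UniversallyClosed.of_comp_surjective f g
  have : QuasiCompact g := inferInstance
  have : IsProper g := ⟨⟩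
  have : LocallyQuasiFinite g := by
    refine LocallyQuasiFinite.of_finite_preimage_singleton _ fun x => ?_
    have := (f ≫ g).finite_preimage_singleton x
    rw [Scheme.Hom.comp_base, TopCat.coe_comp, Set.preimage_comp] at this
    exact this.of_preimage f.surjective
  exact IsFinite.of_isProper_of_locallyQuasiFinite g

lemma support_inf (I J : Y.IdealSheafData) : (I ⊓ J).support = I.support ⊔ J.support := by
  have h : I * J ≤ I ⊓ J := fun U => Ideal.mul_le_inf
  exact le_antisymm (Scheme.IdealSheafData.support_antitone h)
    (sup_le (Scheme.IdealSheafData.support_antitone inf_le_left)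
      (Scheme.IdealSheafData.support_antitone inf_le_right))

/-- The union of two finite closed subschemes is finite, being dominated by their disjoint union. -/
lemma isFinite_inf (p : Y ⟶ S) [IsSeparated p] (I J : Y.IdealSheafData)
    [IsFinite (I.subschemeι ≫ p)] [IsFinite (J.subschemeι ≫ p)]
    [LocallyOfFiniteType ((I ⊓ J).subschemeι ≫ p)] : IsFinite ((I ⊓ J).subschemeι ≫ p) := by
  let f : I.subscheme ⨿ J.subscheme ⟶ (I ⊓ J).subscheme :=
    coprod.desc (Scheme.IdealSheafData.inclusion inf_le_left)
      (Scheme.IdealSheafData.inclusion inf_le_right)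
  have hf : f ≫ (I ⊓ J).subschemeι ≫ p =
      coprod.desc (I.subschemeι ≫ p) (J.subschemeι ≫ p) := by
    ext1 <;> simp [f]
  have : IsFinite (f ≫ (I ⊓ J).subschemeι ≫ p) := by rw [hf]; infer_instance
  have : Surjective f := by
    refine ⟨fun x => ?_⟩
    have hx : (I ⊓ J).subschemeι x ∈ (I ⊓ J).support :=
      (I ⊓ J).range_subschemeι.le ⟨x, rfl⟩
    rw [support_inf] at hx
    replace hx : (I ⊓ J).subschemeι x ∈ (I.support : Set Y) ∪ J.support := hx
    have hinj := (I ⊓ J).subschemeι.isEmbedding.injective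
    rw [← I.range_subschemeι, ← J.range_subschemeι] at hx
    obtain ⟨z, hz⟩ | ⟨z, hz⟩ := hx
    · have h : coprod.inl ≫ f ≫ (I ⊓ J).subschemeι = I.subschemeι := by
        rw [coprod.inl_desc_assoc, Scheme.IdealSheafData.inclusion_subschemeι]
      exact ⟨(coprod.inl : _ ⟶ I.subscheme ⨿ J.subscheme) z, hinj (congr($h z).trans hz)⟩
    · have h : coprod.inr ≫ f ≫ (I ⊓ J).subschemeι = J.subschemeι := by
        rw [coprod.inr_desc_assoc, Scheme.IdealSheafData.inclusion_subschemeι]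
      exact ⟨(coprod.inr : _ ⟶ I.subscheme ⨿ J.subscheme) z, hinj (congr($h z).trans hz)⟩
  exact isFinite_of_surjective f _

end Finite

section Flags

variable {Y S : Scheme.{0}}

/-- The closed subscheme of the affine open `U` with ideal `I` is flat over `Γ(S, ⊤)`. -/
def IsFlatOn (p : Y ⟶ S) (U : Y.affineOpens) (I : Ideal Γ(Y, U)) : Prop :=
  let := (p.appLE ⊤ U.1 le_top).hom.toAlgebra
  Module.Flat Γ(S, ⊤) (Γ(Y, U) ⧸ I)

lemma flat_subscheme_iff [IsAffine S] (p : Y ⟶ S) (I : Y.IdealSheafData) {ι : Type*}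
    (U : ι → Y.affineOpens) (hU : ∀ y, ∃ i, y ∈ (U i).1) :
    Flat (I.subschemeι ≫ p) ↔ ∀ i, IsFlatOn p (U i) (I.ideal (U i)) := by
  rw [subscheme_iff (P := @Flat) p I U hU]
  refine forall_congr' fun i => ?_
  let := (p.appLE ⊤ (U i).1 le_top).hom.toAlgebra
  exact RingHom.flat_algebraMap_iff (R := Γ(S, ⊤)) (S := Γ(Y, U i) ⧸ I.ideal (U i))

lemma isFlatOn [IsAffine S] (p : Y ⟶ S) (I : Y.IdealSheafData) (h : Flat (I.subschemeι ≫ p))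
    (U : Y.affineOpens) : IsFlatOn p U (I.ideal U) :=
  (flat_subscheme_iff p I (fun U : Y.affineOpens => U) fun y =>
    let ⟨U, hU, _⟩ := exists_affineOpens_le y ⊤ trivial
    ⟨U, hU⟩).1 h U

lemma flat_of_local [IsAffine S] (p : Y ⟶ S) (I : Y.IdealSheafData)
    (h : ∀ y, ∃ U : Y.affineOpens, y ∈ U.1 ∧ IsFlatOn p U (I.ideal U)) :
    Flat (I.subschemeι ≫ p) := by
  choose U hU h using h
  exact (flat_subscheme_iff p I U fun y => ⟨y, hU y⟩).2 h

lemma finitePresentation_subscheme_iff [IsAffine S] (p : Y ⟶ S) [LocallyOfFinitePresentation p]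
    (I : Y.IdealSheafData) {ι : Type*} (U : ι → Y.affineOpens) (hU : ∀ y, ∃ i, y ∈ (U i).1) :
    LocallyOfFinitePresentation (I.subschemeι ≫ p) ↔ ∀ i, (I.ideal (U i)).FG := by
  rw [subscheme_iff (P := @LocallyOfFinitePresentation) p I U hU]
  refine forall_congr' fun i => ?_
  algebraize [(p.appLE ⊤ (U i).1 le_top).hom]
  have hp : Algebra.FinitePresentation Γ(S, ⊤) Γ(Y, U i) := by
    rw [← RingHom.finitePresentation_algebraMap]
    exact HasRingHomProperty.appLE @LocallyOfFinitePresentation p inferInstance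
      ⟨⊤, isAffineOpen_top S⟩ (U i) le_top
  refine (RingHom.finitePresentation_algebraMap (A := Γ(S, ⊤))
    (B := Γ(Y, U i) ⧸ I.ideal (U i))).trans ⟨fun h => ?_, fun h => ?_⟩
  · have := Algebra.FinitePresentation.ker_fG_of_surjective
      (Ideal.Quotient.mkₐ Γ(S, ⊤) (I.ideal (U i))) Ideal.Quotient.mk_surjective
    simpa using this
  · exact Algebra.FinitePresentation.quotient h

lemma ideal_fg [IsAffine S] (p : Y ⟶ S) [LocallyOfFinitePresentation p]
    (I : Y.IdealSheafData) (h : LocallyOfFinitePresentation (I.subschemeι ≫ p))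
    (U : Y.affineOpens) : (I.ideal U).FG :=
  (finitePresentation_subscheme_iff p I (fun U : Y.affineOpens => U) fun y =>
    let ⟨U, hU, _⟩ := exists_affineOpens_le y ⊤ trivial
    ⟨U, hU⟩).1 h U

lemma finitePresentation_of_local [IsAffine S] (p : Y ⟶ S) [LocallyOfFinitePresentation p]
    (I : Y.IdealSheafData) (h : ∀ y, ∃ U : Y.affineOpens, y ∈ U.1 ∧ (I.ideal U).FG) :
    LocallyOfFinitePresentation (I.subschemeι ≫ p) := by
  choose U hU h using h
  exact (finitePresentation_subscheme_iff p I U fun y => ⟨y, hU y⟩).2 h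

lemma IsFlatOn.inf {p : Y ⟶ S} {U : Y.affineOpens} {I J : Ideal Γ(Y, U)} (hI : IsFlatOn p U I)
    (hJ : IsFlatOn p U J) (hIJ : IsFlatOn p U (I ⊔ J)) : IsFlatOn p U (I ⊓ J) :=
  letI := (p.appLE ⊤ U.1 le_top).hom.toAlgebra
  flat_quotient_inf (R := Γ(S, ⊤)) hI hJ hIJ

lemma IsFlatOn.span_mul {p : Y ⟶ S} {U : Y.affineOpens} {f g : Γ(Y, U)}
    (hf : f ∈ nonZeroDivisors Γ(Y, U)) (h₁ : IsFlatOn p U (Ideal.span {f}))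
    (h₂ : IsFlatOn p U (Ideal.span {g})) : IsFlatOn p U (Ideal.span {f * g}) :=
  letI := (p.appLE ⊤ U.1 le_top).hom.toAlgebra
  flat_quotient_span_mul (R := Γ(S, ⊤)) hf h₁ h₂

/-- Goodness of a pair of flags, with the Cartier condition on `F.D ∩ G.D` in terms of local
equations on `Y`. -/
lemma isGood_iff (p : Y ⟶ S) (F G : SubPair Y) :
    IsGood p F G ↔ IsFlag p F ∧ IsFlag p G ∧
      (∀ y, ∃ U : Y.affineOpens, y ∈ U.1 ∧ IsRegularOn F.D G.D U) ∧
      Flat ((F.D ⊔ G.D).subschemeι ≫ p) ∧ F.D ⊔ G.D = F.Z ⊔ G.Z := by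
  constructor
  · rintro ⟨hF, hG, h, e⟩
    obtain ⟨h, h'⟩ := (isGoodDivisors_iff p hF.divisor.cartier hG.divisor.cartier).1 h
    exact ⟨hF, hG, h, h', e⟩
  · rintro ⟨hF, hG, h, h', e⟩
    exact ⟨hF, hG, (isGoodDivisors_iff p hF.divisor.cartier hG.divisor.cartier).2 ⟨h, h'⟩, e⟩

lemma isGood_symm {p : Y ⟶ S} {F G : SubPair Y} (h : IsGood p F G) : IsGood p G F where
  flag_left := h.flag_right
  flag_right := h.flag_left
  divisors := ⟨h.divisors.right, h.divisors.left⟩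
  inter := by rw [sup_comm, h.inter, sup_comm]

lemma IsRegularOn.isCartierOn_mul {D E : Y.IdealSheafData} {U : Y.affineOpens}
    (h : IsRegularOn D E U) : IsCartierOn (D * E) U := by
  obtain ⟨f, hf, g, hg, hD, hE, -⟩ := h
  refine ⟨f * g, mul_mem hf hg, ?_⟩
  rw [Scheme.IdealSheafData.ideal_mul, Pi.mul_apply, hD, hE,
    Ideal.span_singleton_mul_span_singleton]

/-- The union of a good pair of flags is a flag. -/
lemma isFlag_union [IsAffine S] {p : Y ⟶ S} [IsSeparated p] [LocallyOfFinitePresentation p]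
    {F G : SubPair Y} (h : IsGood p F G) : IsFlag p (F.union G) := by
  obtain ⟨hF, hG, hreg, hflat, e⟩ := (isGood_iff p F G).1 h
  have hFD := isFlatOn p F.D hF.divisor.flat
  have hGD := isFlatOn p G.D hG.divisor.flat
  have hFZ := isFlatOn p F.Z hF.zeroDim.flat
  have hGZ := isFlatOn p G.Z hG.zeroDim.flat
  have hsup := isFlatOn p _ hflat
  have hfp : LocallyOfFinitePresentation ((F.Z ⊓ G.Z).subschemeι ≫ p) := by
    refine finitePresentation_of_local p _ fun y => ?_
    obtain ⟨U, hyU, f, hf, g, hg, hD, hE, hfg⟩ := hreg y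
    refine ⟨U, hyU, ?_⟩
    have : Module.FinitePresentation Γ(Y, U) ↥(F.Z.ideal U ⊔ G.Z.ideal U) := by
      change Module.FinitePresentation Γ(Y, U) ↥((F.Z ⊔ G.Z).ideal U)
      rw [← e, Scheme.IdealSheafData.ideal_sup, Pi.sup_apply, hD, hE]
      exact finitePresentation_span_sup_span hf hfg
    exact fg_inf_of_finitePresentation_sup (ideal_fg p _ hF.zeroDim.finitePresentation U)
      (ideal_fg p _ hG.zeroDim.finitePresentation U)
  refine ⟨⟨fun y => ?_, flat_of_local p _ fun y => ?_⟩, ⟨?_, flat_of_local p _ fun y => ?_, hfp⟩,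
    ?_⟩
  · obtain ⟨U, hyU, hU⟩ := hreg y
    exact ⟨U, hyU, hU.isCartierOn_mul⟩
  · obtain ⟨U, hyU, f, hf, g, hg, hD, hE, hfg⟩ := hreg y
    refine ⟨U, hyU, ?_⟩
    have h₁ := hFD U
    have h₂ := hGD U
    rw [hD] at h₁
    rw [hE] at h₂
    have := IsFlatOn.span_mul hf h₁ h₂
    rw [← Ideal.span_singleton_mul_span_singleton, ← hD, ← hE] at this
    exact this
  · have := hF.zeroDim.finite
    have := hG.zeroDim.finite
    exact isFinite_inf p F.Z G.Z
  · obtain ⟨U, hyU, -⟩ := hreg y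
    refine ⟨U, hyU, (hFZ U).inf (hGZ U) ?_⟩
    rw [e] at hsup
    exact hsup U
  · exact fun U => Ideal.mul_le_inf.trans (inf_le_inf (hF.nested U) (hG.nested U))

end Flags

/-! ### Associativity of the union -/

section Flags

variable {Y S : Scheme.{0}}

lemma le_of_local {I J : Y.IdealSheafData}
    (h : ∀ y, ∃ U : Y.affineOpens, y ∈ U.1 ∧ I.ideal U ≤ J.ideal U) : I ≤ J := by
  choose U hU h using h
  refine Scheme.IdealSheafData.le_of_iSup_eq_top U (top_le_iff.1 fun y _ => ?_) h
  exact TopologicalSpace.Opens.mem_iSup.2 ⟨y, hU y⟩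

lemma eq_of_local {I J : Y.IdealSheafData}
    (h : ∀ y, ∃ U : Y.affineOpens, y ∈ U.1 ∧ I.ideal U = J.ideal U) : I = J :=
  le_antisymm (le_of_local fun y => let ⟨U, hU, e⟩ := h y; ⟨U, hU, e.le⟩)
    (le_of_local fun y => let ⟨U, hU, e⟩ := h y; ⟨U, hU, e.ge⟩)

lemma isFlag_empty (p : Y ⟶ S) : IsFlag p (empty Y) := by
  have : IsEmpty (⊤ : Y.IdealSheafData).subscheme := inferInstance
  refine ⟨⟨fun y => ?_, ?_⟩, ⟨?_, ?_, ?_⟩, le_rfl⟩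
  · obtain ⟨U, hU, -⟩ := exists_affineOpens_le y ⊤ trivial
    exact ⟨U, hU, 1, one_mem _, Ideal.span_singleton_one.symm⟩
  · change Flat ((⊤ : Y.IdealSheafData).subschemeι ≫ p)
    infer_instance
  · change IsFinite ((⊤ : Y.IdealSheafData).subschemeι ≫ p)
    infer_instance
  · change Flat ((⊤ : Y.IdealSheafData).subschemeι ≫ p)
    infer_instance
  · change LocallyOfFinitePresentation ((⊤ : Y.IdealSheafData).subschemeι ≫ p)
    infer_instance

lemma isGood_empty {p : Y ⟶ S} {F : SubPair Y} (hF : IsFlag p F) : IsGood p F (empty Y) := by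
  refine (isGood_iff p F _).2 ⟨hF, isFlag_empty p, fun y => ?_, ?_, ?_⟩
  · obtain ⟨U, hyU, f, hf, hD⟩ := hF.divisor.cartier y
    refine ⟨U, hyU, f, hf, 1, one_mem _, hD, Ideal.span_singleton_one.symm, fun x hx => ?_⟩
    rwa [one_mul] at hx
  · change Flat ((F.D ⊔ ⊤).subschemeι ≫ p)
    rw [sup_top_eq]
    exact (isFlag_empty p).divisor.flat
  · change F.D ⊔ ⊤ = F.Z ⊔ ⊤
    rw [sup_top_eq, sup_top_eq]

lemma IsFlatOn.of_mul {p : Y ⟶ S} {U : Y.affineOpens} {f g h : Γ(Y, U)}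
    (hh : IsFlatOn p U (Ideal.span {h})) (hfg : IsRegularMod h (f * g))
    (H : IsFlatOn p U (Ideal.span {h} ⊔ Ideal.span {f * g})) :
    IsFlatOn p U (Ideal.span {h} ⊔ Ideal.span {f}) ∧
      IsFlatOn p U (Ideal.span {h} ⊔ Ideal.span {g}) :=
  letI := (p.appLE ⊤ U.1 le_top).hom.toAlgebra
  flat_of_flat_mul (R := Γ(S, ⊤)) hh hfg H

lemma IsFlatOn.mul {p : Y ⟶ S} {U : Y.affineOpens} {f g h : Γ(Y, U)}
    (hh : IsFlatOn p U (Ideal.span {h})) (hf : IsRegularMod h f) (hg : IsRegularMod h g)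
    (hf' : IsFlatOn p U (Ideal.span {h} ⊔ Ideal.span {f}))
    (hg' : IsFlatOn p U (Ideal.span {h} ⊔ Ideal.span {g})) :
    IsFlatOn p U (Ideal.span {h} ⊔ Ideal.span {f * g}) :=
  letI := (p.appLE ⊤ U.1 le_top).hom.toAlgebra
  flat_mul_of_flat (R := Γ(S, ⊤)) hh hf hg hf' hg'

/-- Local equations of three divisors `D₁`, `D₂`, `D₃` such that `D₁`, `D₂` and `D₁ + D₂`, `D₃` meet
properly. -/
lemma exists_equations {D₁ D₂ D₃ : Y.IdealSheafData}
    (h₁₂ : ∀ y, ∃ U : Y.affineOpens, y ∈ U.1 ∧ IsRegularOn D₁ D₂ U)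
    (h₃ : ∀ y, ∃ U : Y.affineOpens, y ∈ U.1 ∧ IsRegularOn (D₁ * D₂) D₃ U) (y : Y) :
    ∃ U : Y.affineOpens, y ∈ U.1 ∧ ∃ f ∈ nonZeroDivisors Γ(Y, U), ∃ g ∈ nonZeroDivisors Γ(Y, U),
      ∃ h ∈ nonZeroDivisors Γ(Y, U), D₁.ideal U = Ideal.span {f} ∧ D₂.ideal U = Ideal.span {g} ∧
        D₃.ideal U = Ideal.span {h} ∧ IsRegularMod f g ∧ IsRegularMod h (f * g) := by
  obtain ⟨U, hyU, ⟨f, hf, g, hg, h₁, h₂, hfg⟩, ⟨k, hk, h, hh, hk', h₃, hkh⟩⟩ :=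
    locally_and IsRegularOn.mono IsRegularOn.mono h₁₂ h₃ y
  rw [Scheme.IdealSheafData.ideal_mul, Pi.mul_apply, h₁, h₂,
    Ideal.span_singleton_mul_span_singleton] at hk'
  exact ⟨U, hyU, f, hf, g, hg, h, hh, h₁, h₂, h₃, hfg, (hkh.swap hk).congr rfl hk'.symm⟩

/-- Associativity of the union, in one direction; the other one follows by symmetry. -/
lemma isGood_assoc [IsAffine S] {p : Y ⟶ S} [IsSeparated p] [LocallyOfFinitePresentation p]
    {F G H : SubPair Y} (h₁ : IsGood p F G) (h₂ : IsGood p (F.union G) H) :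
    IsGood p G H ∧ IsGood p F (G.union H) := by
  obtain ⟨hF, hG, hreg, hflat, e⟩ := (isGood_iff p F G).1 h₁
  obtain ⟨-, hH, hreg', hflat', e'⟩ := (isGood_iff p _ H).1 h₂
  have hloc := exists_equations hreg hreg'
  have hFD := isFlatOn p F.D hF.divisor.flat
  have hHD := isFlatOn p H.D hH.divisor.flat
  have hsup := isFlatOn p _ hflat
  have hsup' := isFlatOn p _ hflat'
  have hsupU := fun (U : Y.affineOpens) => congr_arg (fun I => I.ideal U) e
  have hsupU' := fun (U : Y.affineOpens) => congr_arg (fun I => I.ideal U) e'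
  simp only [SubPair.union, Scheme.IdealSheafData.ideal_sup, Pi.sup_apply,
    Scheme.IdealSheafData.ideal_mul, Pi.mul_apply, Scheme.IdealSheafData.ideal_inf,
    Pi.inf_apply] at hsup hsup' hsupU hsupU'
  have hflatOn : ∀ (U : Y.affineOpens) (f g h : Γ(Y, U)), F.D.ideal U = Ideal.span {f} →
      G.D.ideal U = Ideal.span {g} → H.D.ideal U = Ideal.span {h} → IsRegularMod h (f * g) →
      IsFlatOn p U (Ideal.span {h} ⊔ Ideal.span {f}) ∧
        IsFlatOn p U (Ideal.span {h} ⊔ Ideal.span {g}) := by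
    intro U f g h h₁ h₂ h₃ hfg
    have a₁ := hsup' U
    have a₂ := hHD U
    rw [h₁, h₂, h₃, Ideal.span_singleton_mul_span_singleton, sup_comm] at a₁
    rw [h₃] at a₂
    exact a₂.of_mul hfg a₁
  have hGH : IsGood p G H := by
    refine (isGood_iff p G H).2 ⟨hG, hH, fun y => ?_, flat_of_local p _ fun y => ?_,
      eq_of_local fun y => ?_⟩ <;>
    obtain ⟨U, hyU, f, hf, g, hg, h, hh, hFU, hGU, hHU, hfg, hhfg⟩ := hloc y <;>
    refine ⟨U, hyU, ?_⟩
    · exact ⟨g, hg, h, hh, hGU, hHU, hhfg.of_mul_right.swap hh⟩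
    · rw [sup_comm]
      change IsFlatOn p U (H.D.ideal U ⊔ G.D.ideal U)
      rw [hGU, hHU]
      exact (hflatOn U f g h hFU hGU hHU hhfg).2
    · have a := hsupU' U
      have hFZ := hF.nested U
      have hGZ := hG.nested U
      have hHZ := hH.nested U
      change G.D.ideal U ⊔ H.D.ideal U = G.Z.ideal U ⊔ H.Z.ideal U
      rw [hFU, hGU, hHU, Ideal.span_singleton_mul_span_singleton] at a
      rw [hFU] at hFZ
      rw [hGU] at hGZ ⊢
      rw [hHU] at hHZ ⊢
      exact sup_eq_span_sup_span_of_mul ((Ideal.span_singleton_le_iff_mem _).1 hFZ)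
        ((Ideal.span_singleton_le_iff_mem _).1 hGZ) ((Ideal.span_singleton_le_iff_mem _).1 hHZ)
        hhfg.of_mul_left a
  refine ⟨hGH, (isGood_iff p F _).2 ⟨hF, isFlag_union hGH, fun y => ?_,
      flat_of_local p _ fun y => ?_, eq_of_local fun y => ?_⟩⟩ <;>
  obtain ⟨U, hyU, f, hf, g, hg, h, hh, hFU, hGU, hHU, hfg, hhfg⟩ := hloc y <;>
  refine ⟨U, hyU, ?_⟩
  · exact ⟨f, hf, g * h, mul_mem hg hh, hFU,
      by rw [← Ideal.span_singleton_mul_span_singleton, ← hGU, ← hHU]; rfl,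
      hfg.mul (hhfg.of_mul_left.swap hh)⟩
  · have a := hsup U
    have b := hFD U
    have c := (hflatOn U f g h hFU hGU hHU hhfg).1
    change IsFlatOn p U (F.D.ideal U ⊔ G.D.ideal U * H.D.ideal U)
    rw [sup_comm] at c
    rw [hFU] at a b ⊢
    rw [hGU] at a ⊢
    rw [hHU, Ideal.span_singleton_mul_span_singleton]
    exact b.mul hfg (hhfg.of_mul_left.swap hh) a c
  · have a := hsupU' U
    have b := hsupU U
    have hFZ := hF.nested U
    have hGZ := hG.nested U
    have hHZ := hH.nested U
    change F.D.ideal U ⊔ G.D.ideal U * H.D.ideal U = F.Z.ideal U ⊔ (G.Z.ideal U ⊓ H.Z.ideal U)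
    rw [hFU, hGU, hHU, Ideal.span_singleton_mul_span_singleton] at a
    rw [hFU, hGU] at b
    rw [hFU] at hFZ ⊢
    rw [hGU] at hGZ ⊢
    rw [hHU] at hHZ ⊢
    rw [Ideal.span_singleton_mul_span_singleton]
    exact span_sup_span_mul_eq ((Ideal.span_singleton_le_iff_mem _).1 hFZ)
      ((Ideal.span_singleton_le_iff_mem _).1 hGZ) ((Ideal.span_singleton_le_iff_mem _).1 hHZ)
      hhfg.of_mul_left hhfg.of_mul_right b a

/-- The union as the multiplication of a commutative monoid. It is total on pairs of closed
subschemes; it is only between good pairs that it preserves flags. -/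
instance : CommMonoid (SubPair Y) where
  mul := union
  one := empty Y
  mul_assoc F G H := SubPair.ext (mul_assoc _ _ _) (inf_assoc _ _ _)
  one_mul F := SubPair.ext (one_mul _) (top_inf_eq _)
  mul_one F := SubPair.ext (mul_one _) (inf_top_eq _)
  mul_comm F G := SubPair.ext (mul_comm _ _) (inf_comm _ _)

lemma isPartialCommMonoid_isGood [IsAffine S] (p : Y ⟶ S) [IsSeparated p]
    [LocallyOfFinitePresentation p] : IsPartialCommMonoid (IsGood p) where
  symm h := isGood_symm h
  one_one := isGood_empty (isFlag_empty p)
  left h := isGood_empty h.flag_left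
  mul h := isGood_empty (isFlag_union h)
  assoc h₁ h₂ := isGood_assoc h₁ h₂

end Flags

/-! ### Base change of flags -/

section BaseChange

variable {Y Y' S S' : Scheme.{0}} {g : Y' ⟶ Y} {p' : Y' ⟶ S'} {p : Y ⟶ S} {s : S' ⟶ S}

/-- Inverse images of closed subschemes are base changes of them over the base. -/
lemma isPullback_comap (H : IsPullback g p' p s) (I : Y.IdealSheafData) :
    ∃ g' : (I.comap g).subscheme ⟶ I.subscheme,
      IsPullback g' ((I.comap g).subschemeι ≫ p') (I.subschemeι ≫ p) s := by
  have h : IsPullback ((I.comapIso g).hom ≫ pullback.snd g I.subschemeι) (I.comap g).subschemeι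
      I.subschemeι g := by
    refine IsPullback.of_iso (IsPullback.of_hasPullback g I.subschemeι).flip
      (I.comapIso g).symm (Iso.refl _) (Iso.refl _) (Iso.refl _) ?_ ?_ ?_ ?_
    · rw [Iso.symm_hom, Iso.refl_hom, Category.comp_id, Iso.inv_hom_id_assoc]
    all_goals simp
  exact ⟨_, h.paste_vert H⟩

lemma isRelFlat_comap (H : IsPullback g p' p s) {I : Y.IdealSheafData}
    (h : Flat (I.subschemeι ≫ p)) : Flat ((I.comap g).subschemeι ≫ p') :=
  let ⟨_, h'⟩ := isPullback_comap H I
  MorphismProperty.of_isPullback h' h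

lemma IsZeroDimFamily.comap (H : IsPullback g p' p s) {I : Y.IdealSheafData}
    (h : IsZeroDimFamily p I) : IsZeroDimFamily p' (I.comap g) := by
  obtain ⟨_, h'⟩ := isPullback_comap H I
  exact ⟨MorphismProperty.of_isPullback h' h.finite, MorphismProperty.of_isPullback h' h.flat,
    MorphismProperty.of_isPullback h' h.finitePresentation⟩

lemma isRegularMod_of_isPushout {R R' A A' : CommRingCat.{0}} {b : R ⟶ A} {c : R ⟶ R'} {j : A ⟶ A'}
    {i : R' ⟶ A'} (H : IsPushout b c j i) {f a : A} (hfa : IsRegularMod f a)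
    (hflat : letI := b.hom.toAlgebra; Module.Flat R (A ⧸ Ideal.span {f} ⊔ Ideal.span {a})) :
    IsRegularMod (j.hom f) (j.hom a) := by
  let := b.hom.toAlgebra
  let := c.hom.toAlgebra
  let := j.hom.toAlgebra
  let := i.hom.toAlgebra
  let := (i.hom.comp c.hom).toAlgebra
  have h₁ : IsScalarTower R R' A' := .of_algebraMap_eq' rfl
  have h₂ : IsScalarTower R A A' := .of_algebraMap_eq' (congr_arg CommRingCat.Hom.hom H.w).symm
  have h₃ : Algebra.IsPushout R R' A A' := CommRingCat.isPushout_iff_isPushout.1 H.flip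
  exact isRegularMod_algebraMap R' A' (isUnivRegular_span_of_flat (R := R) hfa hflat R')

lemma map_inf_of_isPushout {R R' A A' : CommRingCat.{0}} {b : R ⟶ A} {c : R ⟶ R'} {j : A ⟶ A'}
    {i : R' ⟶ A'} (H : IsPushout b c j i) {I J : Ideal A}
    (hflat : letI := b.hom.toAlgebra; Module.Flat R (A ⧸ I ⊔ J)) :
    (I ⊓ J).map j.hom = I.map j.hom ⊓ J.map j.hom := by
  let := b.hom.toAlgebra
  let := c.hom.toAlgebra
  let := j.hom.toAlgebra
  let := i.hom.toAlgebra
  let := (i.hom.comp c.hom).toAlgebra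
  have h₁ : IsScalarTower R R' A' := .of_algebraMap_eq' rfl
  have h₂ : IsScalarTower R A A' := .of_algebraMap_eq' (congr_arg CommRingCat.Hom.hom H.w).symm
  have h₃ : Algebra.IsPushout R R' A A' := CommRingCat.isPushout_iff_isPushout.1 H.flip
  exact map_algebraMap_inf (R := R) R' A' hflat

variable [IsAffine S] [IsAffine S']

lemma isPushout_app (H : IsPullback g p' p s) (U : Y.affineOpens) :
    IsPushout (p.appLE ⊤ U.1 le_top) (s.appLE ⊤ ⊤ le_top) (g.appLE U.1 (g ⁻¹ᵁ U.1) le_rfl)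
      (p'.appLE ⊤ (g ⁻¹ᵁ U.1) le_top) := by
  have hUY : g ⁻¹ᵁ U.1 = g ⁻¹ᵁ U.1 ⊓ p' ⁻¹ᵁ ⊤ := by simp
  exact (isIso_pushoutSection_iff H (US := ⊤) (UT := ⊤) (UX := U.1) le_top le_top hUY).1
      (isIso_pushoutSection_of_isAffineOpen H le_top le_top hUY (isAffineOpen_top S)
        (isAffineOpen_top S') U.2)

lemma ideal_comap_preimage [IsAffineHom g] (I : Y.IdealSheafData) (U : Y.affineOpens) :
    (I.comap g).ideal ⟨g ⁻¹ᵁ U.1, U.2.preimage _⟩ =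
      (I.ideal U).map (g.appLE U.1 (g ⁻¹ᵁ U.1) le_rfl).hom :=
  ideal_comap I g U ⟨g ⁻¹ᵁ U.1, U.2.preimage _⟩ le_rfl

/-- Equations of relative effective Cartier divisors stay nonzerodivisors after base change. -/
lemma mem_nonZeroDivisors_appLE (H : IsPullback g p' p s) {U : Y.affineOpens} {f : Γ(Y, U)}
    (hf : f ∈ nonZeroDivisors Γ(Y, U)) (hflat : IsFlatOn p U (Ideal.span {f})) :
    (g.appLE U.1 (g ⁻¹ᵁ U.1) le_rfl).hom f ∈ nonZeroDivisors Γ(Y', g ⁻¹ᵁ U.1) := by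
  rw [← isRegularMod_zero_iff] at hf ⊢
  rw [← map_zero (g.appLE U.1 (g ⁻¹ᵁ U.1) le_rfl).hom]
  refine isRegularMod_of_isPushout (isPushout_app H U) hf ?_
  rwa [Set.singleton_zero, Ideal.span_zero, bot_sup_eq]

lemma IsRelEffectiveCartier.comap (H : IsPullback g p' p s) {D : Y.IdealSheafData}
    (h : IsRelEffectiveCartier p D) : IsRelEffectiveCartier p' (D.comap g) := by
  have : IsAffineHom g := MorphismProperty.of_isPullback H.flip inferInstance
  refine ⟨fun y => ?_, isRelFlat_comap H h.flat⟩
  obtain ⟨U, hyU, f, hf, hD⟩ := h.cartier (g y)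
  refine ⟨⟨g ⁻¹ᵁ U.1, U.2.preimage _⟩, hyU, _, mem_nonZeroDivisors_appLE H hf ?_, ?_⟩
  · rw [← hD]
    exact isFlatOn p D h.flat U
  · rw [ideal_comap_preimage, hD, Ideal.map_span, Set.image_singleton]

lemma SubPair.IsFlag.comap (H : IsPullback g p' p s) {F : SubPair Y} (h : IsFlag p F) :
    IsFlag p' (F.comap g) :=
  ⟨h.divisor.comap H, h.zeroDim.comap H, Scheme.IdealSheafData.comap_mono g h.nested⟩

lemma SubPair.IsGood.comap (H : IsPullback g p' p s) {F G : SubPair Y} (h : IsGood p F G) :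
    IsGood p' (F.comap g) (G.comap g) := by
  have : IsAffineHom g := MorphismProperty.of_isPullback H.flip inferInstance
  obtain ⟨hF, hG, hreg, hflat, e⟩ := (isGood_iff p F G).1 h
  refine (isGood_iff p' _ _).2 ⟨hF.comap H, hG.comap H, fun y => ?_, ?_, ?_⟩
  · obtain ⟨U, hyU, f, hf, a, ha, hD, hE, hfa⟩ := hreg (g y)
    have hU := isFlatOn p _ hflat U
    have hFU := isFlatOn p _ hF.divisor.flat U
    have hGU := isFlatOn p _ hG.divisor.flat U
    rw [Scheme.IdealSheafData.ideal_sup, Pi.sup_apply, hD, hE] at hU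
    rw [hD] at hFU
    rw [hE] at hGU
    refine ⟨⟨g ⁻¹ᵁ U.1, U.2.preimage _⟩, hyU, _, mem_nonZeroDivisors_appLE H hf hFU, _,
      mem_nonZeroDivisors_appLE H ha hGU, ?_, ?_,
      isRegularMod_of_isPushout (isPushout_app H U) hfa hU⟩
    · exact (ideal_comap_preimage F.D U).trans
        (by rw [hD, Ideal.map_span, Set.image_singleton])
    · exact (ideal_comap_preimage G.D U).trans
        (by rw [hE, Ideal.map_span, Set.image_singleton])
  · change Flat ((F.D.comap g ⊔ G.D.comap g).subschemeι ≫ p')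
    rw [← Scheme.IdealSheafData.comap_sup]
    exact isRelFlat_comap H hflat
  · change F.D.comap g ⊔ G.D.comap g = F.Z.comap g ⊔ G.Z.comap g
    rw [← Scheme.IdealSheafData.comap_sup, ← Scheme.IdealSheafData.comap_sup, e]

/-- Inverse images along base changes are compatible with unions of good pairs. The intersection of
the ideals of `F.Z` and `G.Z` is preserved because `F.Z ∩ G.Z = F.D ∩ G.D` is flat over the base. -/
lemma comap_union (H : IsPullback g p' p s) {F G : SubPair Y} (h : IsGood p F G) :
    (F.union G).comap g = (F.comap g).union (G.comap g) := by
  have : IsAffineHom g := MorphismProperty.of_isPullback H.flip inferInstance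
  obtain ⟨hF, hG, -, hflat, e⟩ := (isGood_iff p F G).1 h
  refine SubPair.ext (eq_of_local fun y => ?_) (eq_of_local fun y => ?_) <;>
  obtain ⟨U, hyU, -⟩ := exists_affineOpens_le (g y) ⊤ trivial <;>
  refine ⟨⟨g ⁻¹ᵁ U.1, U.2.preimage _⟩, hyU, ?_⟩
  · refine (ideal_comap_preimage (F.D * G.D) U).trans ?_
    change _ = (F.D.comap g).ideal ⟨g ⁻¹ᵁ U.1, U.2.preimage _⟩ *
      (G.D.comap g).ideal ⟨g ⁻¹ᵁ U.1, U.2.preimage _⟩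
    rw [ideal_comap_preimage, ideal_comap_preimage, ← Ideal.map_mul]
    rfl
  · refine (ideal_comap_preimage (F.Z ⊓ G.Z) U).trans ?_
    change _ = (F.Z.comap g).ideal ⟨g ⁻¹ᵁ U.1, U.2.preimage _⟩ ⊓
      (G.Z.comap g).ideal ⟨g ⁻¹ᵁ U.1, U.2.preimage _⟩
    rw [ideal_comap_preimage, ideal_comap_preimage]
    refine map_inf_of_isPushout (isPushout_app H U) ?_
    rw [e] at hflat
    exact isFlatOn p _ hflat U

end BaseChange

/-! ### The order of flags and flag tuples -/

section Tuples

variable {Y Y' S S' : Scheme.{0}}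

lemma radical_eq_iff {I J : Y.IdealSheafData} : I.radical = J.radical ↔ I.support = J.support := by
  refine ⟨fun h => ?_, fun h => ?_⟩
  · rw [← I.support_radical, h, J.support_radical]
  · rw [← Scheme.IdealSheafData.vanishingIdeal_support, h,
      Scheme.IdealSheafData.vanishingIdeal_support]

lemma SubPair.FlagLE.comap {F G : SubPair Y} (h : FlagLE F G) (g : Y' ⟶ Y) :
    FlagLE (F.comap g) (G.comap g) := by
  refine ⟨Scheme.IdealSheafData.comap_mono g h.divisor, Scheme.IdealSheafData.comap_mono g h.points,
    radical_eq_iff.2 ?_⟩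
  change (F.Z.comap g).support = (F.D.comap g ⊔ G.Z.comap g).support
  rw [← Scheme.IdealSheafData.comap_sup, Scheme.IdealSheafData.support_comap,
    Scheme.IdealSheafData.support_comap, radical_eq_iff.1 h.red]

/-- The union of good pairs is monotone: if `F' ≤ F` and `G' ≤ G`, then `F'.D ∩ G.Z` is contained in
`F.D ∩ G.D = F.Z ∩ G.Z`, hence in `F'.D ∩ F.Z`, which is `F'.Z` as a set. -/
lemma flagLE_union {F F' G G' : SubPair Y} (hG : G.D ≤ G.Z) (hF : F.D ≤ F.Z)
    (e : F.D ⊔ G.D = F.Z ⊔ G.Z) (h₁ : FlagLE F' F) (h₂ : FlagLE G' G) :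
    FlagLE (F'.union G') (F.union G) := by
  refine ⟨fun U => Ideal.mul_mono (h₁.divisor U) (h₂.divisor U), inf_le_inf h₁.points h₂.points,
    radical_eq_iff.2 ?_⟩
  have e' := congr_arg (fun I => (I.support : Set Y)) e
  have e₁ := congr_arg (fun I : TopologicalSpace.Closeds Y => (I : Set Y)) (radical_eq_iff.1 h₁.red)
  have e₂ := congr_arg (fun I : TopologicalSpace.Closeds Y => (I : Set Y)) (radical_eq_iff.1 h₂.red)
  have d₁ : (F'.D.support : Set Y) ⊆ F.D.support :=
    Scheme.IdealSheafData.support_antitone h₁.divisor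
  have d₂ : (G'.D.support : Set Y) ⊆ G.D.support :=
    Scheme.IdealSheafData.support_antitone h₂.divisor
  have hF' : (F.Z.support : Set Y) ⊆ F.D.support := Scheme.IdealSheafData.support_antitone hF
  have hG' : (G.Z.support : Set Y) ⊆ G.D.support := Scheme.IdealSheafData.support_antitone hG
  refine TopologicalSpace.Closeds.ext ?_
  change ((F'.Z ⊓ G'.Z).support : Set Y) = (F'.D * G'.D ⊔ F.Z ⊓ G.Z).support
  simp only [support_inf, Scheme.IdealSheafData.support_sup, Scheme.IdealSheafData.support_mul,
    TopologicalSpace.Closeds.coe_sup, TopologicalSpace.Closeds.coe_inf] at e' e₁ e₂ ⊢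
  rw [e₁, e₂]
  ext y
  have e₃ := Set.ext_iff.1 e' y
  have d₁ := @d₁ y
  have d₂ := @d₂ y
  have hF' := @hF' y
  have hG' := @hG' y
  simp only [Set.mem_union, Set.mem_inter_iff] at e₃ ⊢
  tauto

variable {n m : ℕ}

lemma flagLE_segProd {p : Y ⟶ S} {F G : Fin n → SubPair Y} (hG : IsComposable (IsGood p) G)
    (h : ∀ i, FlagLE (F i) (G i)) {x y : ℕ} (hxy : x ≤ y) (hy : y ≤ n) :
    FlagLE (segProd F x y) (segProd G x y) := by
  induction y, hxy using Nat.le_induction with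
  | base =>
    rw [segProd_self, segProd_self]
    exact FlagLE.refl (isFlag_empty p)
  | succ y hxy ih =>
    have hgood := hG x y (y + 1) hxy (Nat.le_succ y) hy
    rw [← segProd_mul F hxy (Nat.le_succ y), ← segProd_mul G hxy (Nat.le_succ y)]
    refine flagLE_union hgood.flag_right.nested hgood.flag_left.nested hgood.inter
      (ih (by omega)) ?_
    rw [segProd_succ F (by omega), segProd_succ G (by omega)]
    exact h _

lemma flagLE_simplexAct {p : Y ⟶ S} {F G : Fin n → SubPair Y} (hG : IsComposable (IsGood p) G)
    (h : ∀ i, FlagLE (F i) (G i)) (φ : Fin (m + 1) →o Fin (n + 1)) (j : Fin m) :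
    FlagLE (simplexAct φ F j) (simplexAct φ G j) :=
  flagLE_segProd hG h (φ.monotone (Fin.castSucc_le_succ j)) (by omega)

section BaseChange

variable [IsAffine S] [IsAffine S'] {g : Y' ⟶ Y} {p' : Y' ⟶ S'} {p : Y ⟶ S} {s : S' ⟶ S}

lemma comap_segProd (H : IsPullback g p' p s) {F : Fin n → SubPair Y}
    (hF : IsComposable (IsGood p) F) {x y : ℕ} (hxy : x ≤ y) (hy : y ≤ n) :
    (segProd F x y).comap g = segProd (fun k => (F k).comap g) x y := by
  induction y, hxy using Nat.le_induction with
  | base =>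
    rw [segProd_self, segProd_self]
    exact SubPair.ext (Scheme.IdealSheafData.comap_top g) (Scheme.IdealSheafData.comap_top g)
  | succ y hxy ih =>
    rw [← segProd_mul F hxy (Nat.le_succ y), ← segProd_mul _ hxy (Nat.le_succ y), ← ih (by omega)]
    refine (comap_union H (hF x y (y + 1) hxy (Nat.le_succ y) hy)).trans ?_
    rw [segProd_succ F (by omega), segProd_succ _ (by omega)]
    rfl

lemma comap_simplexAct (H : IsPullback g p' p s) {F : Fin n → SubPair Y}
    (hF : IsComposable (IsGood p) F) (φ : Fin (m + 1) →o Fin (n + 1)) (j : Fin m) :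
    (simplexAct φ F j).comap g = simplexAct φ (fun k => (F k).comap g) j :=
  comap_segProd H hF (φ.monotone (Fin.castSucc_le_succ j)) (by omega)

lemma IsComposable.comap (H : IsPullback g p' p s) {F : Fin n → SubPair Y}
    (hF : IsComposable (IsGood p) F) : IsComposable (IsGood p') (fun k => (F k).comap g) := by
  intro x y z hxy hyz hz
  rw [← comap_segProd H hF hxy (by omega), ← comap_segProd H hF hyz hz]
  exact (hF x y z hxy hyz hz).comap H

end BaseChange

lemma face_eq_simplexAct (i : Fin (n + 2)) (F : Fin (n + 1) → SubPair Y) :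
    face i F = simplexAct (Fin.succAboveOrderEmb i).toOrderHom F := by
  funext j
  change _ = segProd F (i.succAbove j.castSucc) (i.succAbove j.succ)
  rw [val_succAbove, val_succAbove, Fin.val_castSucc, Fin.val_succ, face]
  split_ifs <;> try omega
  · exact (segProd_succ F (by omega)).symm
  · rw [← segProd_mul F (Nat.le_succ j) (Nat.le_succ (j + 1)), segProd_succ F (by omega),
      segProd_succ F (by omega)]
    rfl
  · exact (segProd_succ F (by omega)).symm

lemma degeneracy_eq_simplexAct (i : Fin (n + 1)) (F : Fin n → SubPair Y) :
    degeneracy i F = simplexAct ⟨i.predAbove, Fin.predAbove_right_monotone i⟩ F := by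
  funext j
  change Fin.insertNth (α := fun _ => SubPair Y) i (empty Y) F j =
    segProd F (i.predAbove j.castSucc) (i.predAbove j.succ)
  have h : ∀ k : Fin (n + 2), (i.predAbove k).val = if i.val < k.val then k.val - 1 else k.val := by
    intro k
    simp only [Fin.predAbove, Fin.lt_def, Fin.val_castSucc]
    split_ifs <;> simp_all
  rw [h, h]
  obtain rfl | hj := eq_or_ne j i
  · rw [Fin.insertNth_apply_same]
    simp only [Fin.val_castSucc, Fin.val_succ]
    rw [if_neg (by omega), if_pos (by omega), Nat.add_sub_cancel, segProd_self]
    rfl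
  obtain ⟨k, rfl⟩ := Fin.exists_succAbove_eq hj
  rw [Fin.insertNth_apply_succAbove]
  simp only [Fin.val_castSucc, Fin.val_succ, val_succAbove]
  split_ifs <;> try omega
  · exact (segProd_succ' F k.is_lt (by omega)).symm
  · exact (segProd_succ' F k.is_lt (by omega)).symm

/-- The inductively defined flag tuples are the tuples all of whose consecutive segments have good
unions. A condition on segments with endpoints `x ≤ y ≤ z` in `{0, …, n}`, `n ≥ 3`, is visible on
the face which omits some other vertex. -/
lemma isFlagTuple_iff [IsAffine S] (p : Y ⟶ S) [IsSeparated p] [LocallyOfFinitePresentation p]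
    (n : ℕ) (F : Fin n → SubPair Y) : IsFlagTuple p n F ↔ IsComposable (IsGood p) F := by
  have hr := isPartialCommMonoid_isGood p
  induction n using Nat.strong_induction_on with
  | h n ih =>
  match n, F, ih with
  | 0, F, _ =>
    exact ⟨fun _ => hr.isComposable_of_chain fun k hk => absurd hk (Nat.not_lt_zero k),
      fun _ => trivial⟩
  | 1, F, _ =>
    refine ⟨fun h => hr.isComposable_of_chain fun k hk => ?_, fun h => ?_⟩
    · obtain rfl : k = 0 := by omega
      rw [segProd_self, segProd_succ F (by omega)]
      exact isGood_symm (isGood_empty h)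
    · have := (h 0 1 1 (by omega) (by omega) (by omega)).flag_left
      rwa [segProd_succ' F (x := 0) (by omega) rfl] at this
  | 2, F, _ =>
    refine ⟨fun h => hr.isComposable_of_chain fun k hk => ?_, fun h => ?_⟩
    · obtain rfl | rfl : k = 0 ∨ k = 1 := by omega
      · rw [segProd_self, segProd_succ F (by omega)]
        exact isGood_symm (isGood_empty h.flag_left)
      · rw [segProd_succ' F (x := 0) (by omega) rfl, segProd_succ F (by omega)]
        exact h
    · have := h 0 1 2 (by omega) (by omega) (by omega)
      rwa [segProd_succ' F (x := 0) (by omega) rfl, segProd_succ' F (x := 1) (by omega) rfl] at this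
  | n + 3, F, ih =>
    constructor
    · rintro ⟨-, h⟩ x y z hxy hyz hz
      obtain ⟨i, hi, hx, hy, hz'⟩ : ∃ i, i < n + 4 ∧ x ≠ i ∧ y ≠ i ∧ z ≠ i := by
        by_contra! H
        have h₀ := H 0
        have h₁ := H 1
        have h₂ := H 2
        have h₃ := H 3
        omega
      have hface := (ih (n + 2) (by omega) _).1 (h ⟨i, hi⟩)
      rw [face_eq_simplexAct] at hface
      exact hface.of_face hxy hyz hz hx hy hz'
    · refine fun h => ⟨fun i => ?_, fun i => (ih (n + 2) (by omega) _).2 ?_⟩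
      · have := (h i (i + 1) (i + 1) (by omega) (by omega) (by omega)).flag_left
        rwa [segProd_succ F i.is_lt] at this
      · rw [face_eq_simplexAct]
        exact h.simplexAct _

end Tuples

/-! ### The simplicial object of flags -/

section Surface

instance (S : AffC) : IsAffine S.obj.left := S.property

section
attribute [local instance] MvPolynomial.gradedAlgebra

lemma isSeparated_projectiveSpaceHom (n : ℕ) : IsSeparated (projectiveSpaceHom n) := by
  unfold projectiveSpaceHom projectiveSpace
  infer_instance
end

lemma prodMap_fst (X : Over SpecC) {S T : AffC} (f : S ⟶ T) :
    prodMap X f ≫ pullback.fst X.hom T.obj.hom = pullback.fst X.hom S.obj.hom :=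
  pullback.lift_fst _ _ _

lemma prodMap_snd (X : Over SpecC) {S T : AffC} (f : S ⟶ T) :
    prodMap X f ≫ proj X T = proj X S ≫ f.hom.left :=
  pullback.lift_snd _ _ _

lemma isPullback_prodMap (X : Over SpecC) {S T : AffC} (f : S ⟶ T) :
    IsPullback (prodMap X f) (proj X S) (proj X T) f.hom.left := by
  have h : IsPullback (prodMap X f ≫ pullback.fst X.hom T.obj.hom) (proj X S) X.hom
      (f.hom.left ≫ T.obj.hom) := by
    rw [Over.w f.hom, prodMap_fst]
    exact IsPullback.of_hasPullback _ _
  exact IsPullback.of_right h (prodMap_snd X f) (IsPullback.of_hasPullback _ _)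

lemma IsSmoothProjectiveSurface.isSeparated {X : Over SpecC} (hX : IsSmoothProjectiveSurface X) :
    IsSeparated X.hom := by
  obtain ⟨n, i, hi, h⟩ := hX.projective
  have := isSeparated_projectiveSpaceHom n
  rw [← h]
  infer_instance

lemma IsSmoothProjectiveSurface.isSeparated_proj {X : Over SpecC} (hX : IsSmoothProjectiveSurface X)
    (S : AffC) : IsSeparated (proj X S) :=
  have := hX.isSeparated
  inferInstance

lemma IsSmoothProjectiveSurface.locallyOfFinitePresentation_proj {X : Over SpecC}
    (hX : IsSmoothProjectiveSurface X) (S : AffC) : LocallyOfFinitePresentation (proj X S) :=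
  have := hX.smooth
  have : Smooth X.hom := SmoothOfRelativeDimension.smooth 2 X.hom
  have : LocallyOfFinitePresentation X.hom := inferInstance
  inferInstance

end Surface

section SimplicialObject

variable {n m : ℕ}

/-- The action of a monotone map on flag tuples at a fixed base. -/
def tupleAct {Y S : Scheme.{0}} [IsAffine S] (p : Y ⟶ S) [IsSeparated p]
    [LocallyOfFinitePresentation p] (φ : Fin (m + 1) →o Fin (n + 1)) :
    FlagTuple p n →o FlagTuple p m where
  toFun F := ⟨simplexAct φ F.1,
    (isFlagTuple_iff p m _).2 (((isFlagTuple_iff p n _).1 F.2).simplexAct φ)⟩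
  monotone' _ G h := flagLE_simplexAct ((isFlagTuple_iff p n _).1 G.2) h φ

/-- The inverse image of flag tuples along a base change. -/
noncomputable def tupleComap {Y Y' S S' : Scheme.{0}} [IsAffine S] [IsAffine S']
    {g : Y' ⟶ Y} {p' : Y' ⟶ S'} {p : Y ⟶ S} {s : S' ⟶ S}
    [IsSeparated p] [LocallyOfFinitePresentation p] [IsSeparated p']
    [LocallyOfFinitePresentation p'] (H : IsPullback g p' p s) (n : ℕ) :
    FlagTuple p n →o FlagTuple p' n where
  toFun F := ⟨fun k => (F.1 k).comap g,
    (isFlagTuple_iff p' n _).2 (((isFlagTuple_iff p n _).1 F.2).comap H)⟩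
  monotone' _ _ h i := (h i).comap g

lemma prodMap_id (X : Over SpecC) (S : AffC) : prodMap X (𝟙 S) = 𝟙 (prodScheme X S) := by
  apply pullback.hom_ext
  · rw [prodMap_fst, Category.id_comp]
  · exact (prodMap_snd X _).trans ((Category.comp_id _).trans (Category.id_comp _).symm)

lemma prodMap_comp (X : Over SpecC) {S T U : AffC} (f : S ⟶ T) (g : T ⟶ U) :
    prodMap X (f ≫ g) = prodMap X f ≫ prodMap X g := by
  apply pullback.hom_ext
  · rw [Category.assoc, prodMap_fst, prodMap_fst, prodMap_fst]
  · change prodMap X (f ≫ g) ≫ proj X U = (prodMap X f ≫ prodMap X g) ≫ proj X U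
    rw [Category.assoc, prodMap_snd, prodMap_snd, ← Category.assoc, prodMap_snd, Category.assoc]
    rfl

variable {X : Over SpecC} (hX : IsSmoothProjectiveSurface X)

/-- The `n`-th level as a presheaf of posets on affine `ℂ`-schemes. -/
noncomputable def flagLevel (n : ℕ) : AffCᵒᵖ ⥤ PartOrd.{0} where
  obj S := PartOrd.of (FlagTuple (proj X S.unop) n)
  map {S T} f :=
    have := hX.isSeparated_proj S.unop
    have := hX.isSeparated_proj T.unop
    have := hX.locallyOfFinitePresentation_proj S.unop
    have := hX.locallyOfFinitePresentation_proj T.unop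
    PartOrd.ofHom (tupleComap (isPullback_prodMap X f.unop) n)
  map_id S := by
    ext F
    refine Subtype.ext (funext fun k => SubPair.ext ?_ ?_)
    · exact (congr_arg _ (prodMap_id X _)).trans (Scheme.IdealSheafData.comap_id _)
    · exact (congr_arg _ (prodMap_id X _)).trans (Scheme.IdealSheafData.comap_id _)
  map_comp f g := by
    ext F
    refine Subtype.ext (funext fun k => SubPair.ext ?_ ?_)
    · exact (congr_arg _ (prodMap_comp X _ _)).trans (Scheme.IdealSheafData.comap_comp _ _ _)
    · exact (congr_arg _ (prodMap_comp X _ _)).trans (Scheme.IdealSheafData.comap_comp _ _ _)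

/-- The simplicial object of flags. -/
noncomputable def flagSimplicial : SimplicialObject (AffCᵒᵖ ⥤ PartOrd.{0}) where
  obj n := flagLevel hX n.unop.len
  map φ :=
    { app S :=
        have := hX.isSeparated_proj S.unop
        have := hX.locallyOfFinitePresentation_proj S.unop
        PartOrd.ofHom (tupleAct (proj X S.unop) φ.unop.toOrderHom)
      naturality S T f := by
        have := hX.isSeparated_proj S.unop
        have := hX.locallyOfFinitePresentation_proj S.unop
        ext F
        refine Subtype.ext (funext fun k => ?_)
        exact (comap_simplexAct (isPullback_prodMap X f.unop)
          ((isFlagTuple_iff _ _ _).1 F.2) φ.unop.toOrderHom k).symm }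
  map_id n := by
    ext S F
    exact Subtype.ext (simplexAct_id _)
  map_comp φ ψ := by
    ext S F
    exact Subtype.ext (simplexAct_comp _ _ _)

lemma isFlagSimplicialObject_flagSimplicial :
    IsFlagSimplicialObject X (flagSimplicial hX)
      (fun n S => OrderIso.refl (FlagTuple (proj X S) n)) where
  pullback _ _ _ _ _ _ := rfl
  face _ i _ _ := (face_eq_simplexAct i _).symm
  degeneracy _ i _ _ := (degeneracy_eq_simplexAct i _).symm

end SimplicialObject

/-! ### Gluing of composable tuples and Cartesian squares of posets -/

section Gluing

variable {M : Type*} [CommMonoid M] {r : M → M → Prop} {a m b n : ℕ}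

namespace IsPartialCommMonoid

/-- Gluing along an edge: a composable tuple on `{0, …, a, a + m, …, a + m + b}` and one on
`{a, …, a + m}` with the same value on the edge `{a, a + m}`. -/
lemma exists_glue_edge (hr : IsPartialCommMonoid r) {o : Fin (a + 1 + b + 1) →o Fin (a + m + b + 1)}
    (ho : ∀ k, (o k).val = if k.val ≤ a then k.val else k.val - 1 + m)
    {ι : Fin (m + 1) →o Fin (a + m + b + 1)} (hι : ∀ k, (ι k).val = a + k.val)
    {G : Fin (a + 1 + b) → M} {G' : Fin m → M} (hG : IsComposable r G) (hG' : IsComposable r G')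
    (h : G ⟨a, by omega⟩ = segProd G' 0 m) :
    ∃ F : Fin (a + m + b) → M, IsComposable r F ∧ simplexAct o F = G ∧ simplexAct ι F = G' := by
  let F : Fin (a + m + b) → M := fun k =>
    if k.val < a then segProd G k (k + 1)
    else if k.val < a + m then segProd G' (k - a) (k - a + 1)
    else segProd G (k + 1 - m) (k + 2 - m)
  have hin : simplexAct ι F = G' := by
    funext j
    have hj := j.is_lt
    rw [simplexAct, hι, hι, Fin.val_castSucc, Fin.val_succ,
      segProd_succ' F (x := a + j) (by omega) (by omega)]
    simp only [F]
    rw [if_neg (by omega), if_pos (by omega), Nat.add_sub_cancel_left]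
    exact segProd_succ G' hj
  have hout : simplexAct o F = G := by
    funext j
    have hj := j.is_lt
    rw [simplexAct, ho, ho, Fin.val_castSucc, Fin.val_succ]
    rcases Nat.lt_trichotomy j.val a with hja | hja | hja
    · rw [if_pos (by omega), if_pos (by omega), segProd_succ F (by omega)]
      simp only [F]
      rw [if_pos hja]
      exact segProd_succ G hj
    · rw [if_pos (by omega), if_neg (by omega), show j = ⟨a, by omega⟩ from Fin.ext hja, h, ← hin]
      have := segProd_simplexAct F ι (Nat.zero_le m) (Nat.lt_succ_self m)
      rw [hι, hι] at this
      rw [this]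
      congr 1
    · rw [if_neg (by omega), if_neg (by omega),
        segProd_succ' F (x := j - 1 + m) (by omega) (by omega)]
      simp only [F]
      rw [if_neg (by omega), if_neg (by omega), segProd_succ' G (x := j - 1 + m + 1 - m) (by omega)
        (by omega)]
      congr 1
      exact Fin.ext (by simp only; omega)
  refine ⟨F, hr.isComposable_of_outer_inner ?_ ?_, hout, hin⟩
  · intro x y z hxy hyz hz hx hy hz'
    -- the vertices outside the open interval `(a, a + m)` come from `G`
    have key : ∀ x : ℕ, x ≤ a + m + b → (x ≤ a ∨ a + m ≤ x) →
        ∃ k : Fin (a + 1 + b + 1), (o k).val = x ∧ (x ≤ a → k.val = x) ∧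
          (a + m ≤ x → ¬ x ≤ a → k.val = x + 1 - m) := by
      intro x hx hx'
      by_cases hxa : x ≤ a
      · exact ⟨⟨x, by omega⟩, by rw [ho]; exact if_pos hxa, fun _ => rfl, fun _ h => absurd hxa h⟩
      · refine ⟨⟨x + 1 - m, by omega⟩, ?_, fun h => absurd h hxa, fun _ _ => rfl⟩
        rw [ho]
        simp only
        split_ifs <;> omega
    obtain ⟨x', hx₁, hx₂, hx₃⟩ := key x (by omega) hx
    obtain ⟨y', hy₁, hy₂, hy₃⟩ := key y (by omega) hy
    obtain ⟨z', hz₁, hz₂, hz₃⟩ := key z (by omega) hz'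
    have hxy' : x'.val ≤ y'.val := by by_cases x ≤ a <;> by_cases y ≤ a <;> omega
    have hyz' : y'.val ≤ z'.val := by by_cases y ≤ a <;> by_cases z ≤ a <;> omega
    have := hG x' y' z' hxy' hyz' (by omega)
    rw [← hout, segProd_simplexAct F o hxy' y'.is_lt, segProd_simplexAct F o hyz' z'.is_lt, hx₁,
      hy₁, hz₁] at this
    exact this
  · intro x y z hxy hyz hx hz
    have := hG' (x - a) (y - a) (z - a) (by omega) (by omega) (by omega)
    rw [← hin, segProd_simplexAct F ι (by omega) (by omega),
      segProd_simplexAct F ι (by omega) (by omega), hι, hι, hι] at this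
    simp only at this
    rwa [Nat.add_sub_cancel' hx, Nat.add_sub_cancel' (hx.trans hxy),
      Nat.add_sub_cancel' (hx.trans (hxy.trans hyz))] at this

/-- Gluing the face omitting the vertex `i + 1` and the face omitting the vertex `0`. -/
lemma exists_glue_zero (hr : IsPartialCommMonoid r) {i : Fin (n + 2)} (hi : 0 < i)
    (hi' : i < Fin.last (n + 1)) {G G' : Fin (n + 1) → M} (hG : IsComposable r G)
    (hG' : IsComposable r G')
    (h : simplexAct (Fin.succAboveOrderEmb 0).toOrderHom G =
      simplexAct (Fin.succAboveOrderEmb i).toOrderHom G') :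
    ∃ F : Fin (n + 2) → M, IsComposable r F ∧
      simplexAct (Fin.succAboveOrderEmb i.succ).toOrderHom F = G ∧
      simplexAct (Fin.succAboveOrderEmb 0).toOrderHom F = G' := by
  have hi₁ : 0 < i.val := hi
  have hi₂ : i.val < n + 1 := hi'
  let F : Fin (n + 2) → M := Fin.cons (G 0) G'
  have h₀ : simplexAct (Fin.succAboveOrderEmb 0).toOrderHom F = G' := by
    funext j
    exact segProd_succ F (x := j + 1) (by omega)
  have h₁ : simplexAct (Fin.succAboveOrderEmb i.succ).toOrderHom F = G := by
    funext j
    induction j using Fin.cases with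
    | zero =>
      have e₁ : (i.succ.succAbove (Fin.castSucc 0)).val = 0 := by
        rw [val_succAbove]
        exact if_pos (by simp)
      have e₂ : (i.succ.succAbove (Fin.succ 0)).val = 1 := by
        rw [val_succAbove]
        exact if_pos (by simpa using hi)
      change segProd F (i.succ.succAbove _) (i.succ.succAbove _) = _
      rw [e₁, e₂, segProd_succ' F (x := 0) (by omega) rfl]
      rfl
    | succ j =>
      have hj : G j.succ = simplexAct (Fin.succAboveOrderEmb 0).toOrderHom G j :=
        (segProd_succ G (x := j + 1) (by omega)).symm
      rw [hj, h, ← h₀, ← simplexAct_comp]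
      change segProd F (i.succ.succAbove _) (i.succ.succAbove _) =
        segProd F (Fin.succ (i.succAbove _)) (Fin.succ (i.succAbove _))
      simp only [val_succAbove, Fin.val_castSucc, Fin.val_succ]
      congr 1 <;> split_ifs <;> omega
  have hi₃ : i.succ.val = i.val + 1 := Fin.val_succ i
  refine ⟨F, hr.isComposable_of_chain fun k hk => ?_, h₁, h₀⟩
  rw [← h₁] at hG
  rw [← h₀] at hG'
  -- the triples `0, i, i + 1` and `0, i + 1, i + 2` lie on neither face, but they triangulate a
  -- quadrilateral whose other triangulation consists of faces of the two given ones
  by_cases hk₁ : k = i.val + 1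
  · subst hk₁
    exact (hr.quad' (Nat.zero_le i) (Nat.le_succ _) (Nat.le_succ _)
      (hG'.of_face (by omega) (by omega) (by omega) (by simp; omega) (by simp) (by simp))
      (hG.of_face (by omega) (by omega) (by omega) (by omega) (by omega) (by omega))).2
  by_cases hk₂ : k = i.val
  · subst hk₂
    exact (hr.quad' (z := i.val + 2) (Nat.zero_le i) (Nat.le_succ _) (Nat.le_succ _)
      (hG'.of_face (by omega) (by omega) (by omega) (by simp; omega) (by simp) (by simp))
      (hG.of_face (by omega) (by omega) (by omega) (by omega) (by omega) (by omega))).1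
  exact hG.of_face (by omega) (by omega) (by omega) (by omega) (by omega) (by omega)

/-- Gluing the face omitting the vertex `i` and the face omitting the last vertex. -/
lemma exists_glue_last (hr : IsPartialCommMonoid r) {i : Fin (n + 2)} (hi : 0 < i)
    (hi' : i < Fin.last (n + 1)) {G G' : Fin (n + 1) → M} (hG : IsComposable r G)
    (hG' : IsComposable r G')
    (h : simplexAct (Fin.succAboveOrderEmb (Fin.last (n + 1))).toOrderHom G =
      simplexAct (Fin.succAboveOrderEmb i).toOrderHom G') :
    ∃ F : Fin (n + 2) → M, IsComposable r F ∧
      simplexAct (Fin.succAboveOrderEmb i.castSucc).toOrderHom F = G ∧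
      simplexAct (Fin.succAboveOrderEmb (Fin.last (n + 2))).toOrderHom F = G' := by
  have hi₁ : 0 < i.val := hi
  have hi₂ : i.val < n + 1 := hi'
  let F : Fin (n + 2) → M := Fin.snoc (α := fun _ => M) G' (G (Fin.last n))
  have hlast : ∀ {l : ℕ} (k : Fin l), ((Fin.last l).succAbove k).val = k.val := fun k => by
    rw [Fin.succAbove_last, Fin.val_castSucc]
  have h₀ : simplexAct (Fin.succAboveOrderEmb (Fin.last (n + 2))).toOrderHom F = G' := by
    funext j
    change segProd F ((Fin.last (n + 2)).succAbove _) ((Fin.last (n + 2)).succAbove _) = _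
    rw [hlast, hlast]
    exact (segProd_succ F (x := j) (by omega)).trans
      (Fin.snoc_castSucc (α := fun _ => M) (G (Fin.last n)) G' j)
  have h₁ : simplexAct (Fin.succAboveOrderEmb i.castSucc).toOrderHom F = G := by
    funext j
    induction j using Fin.lastCases with
    | last =>
      change segProd F (i.castSucc.succAbove _) (i.castSucc.succAbove _) = _
      rw [val_succAbove, val_succAbove]
      simp only [Fin.val_castSucc, Fin.val_succ, Fin.val_last]
      rw [if_neg (by omega), if_neg (by omega), segProd_succ F (x := n + 1) (by omega)]
      exact Fin.snoc_last (α := fun _ => M) (G (Fin.last n)) G'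
    | cast j =>
      have hj : G j.castSucc =
          simplexAct (Fin.succAboveOrderEmb (Fin.last (n + 1))).toOrderHom G j := by
        change _ = segProd G ((Fin.last (n + 1)).succAbove _) ((Fin.last (n + 1)).succAbove _)
        rw [hlast, hlast]
        exact (segProd_succ G (x := j) (by omega)).symm
      rw [hj, h, ← h₀, ← simplexAct_comp]
      change segProd F (i.castSucc.succAbove _) (i.castSucc.succAbove _) =
        segProd F ((Fin.last (n + 2)).succAbove (i.succAbove _))
          ((Fin.last (n + 2)).succAbove (i.succAbove _))
      simp only [hlast, val_succAbove, Fin.val_castSucc, Fin.val_succ]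
  have hi₃ : i.castSucc.val = i.val := Fin.val_castSucc i
  have hi₄ : (Fin.last (n + 2)).val = n + 2 := Fin.val_last _
  refine ⟨F, hr.isComposable_of_chain fun k hk => ?_, h₁, h₀⟩
  rw [← h₁] at hG
  rw [← h₀] at hG'
  -- as `0 < i < n + 1`, the triple `0, n + 1, n + 2` omits the vertex `i`
  by_cases hk₁ : k = n + 1
  · exact hG.of_face (by omega) (by omega) (by omega) (by omega) (by omega) (by omega)
  · exact hG'.of_face (by omega) (by omega) (by omega) (by omega) (by omega) (by omega)

end IsPartialCommMonoid

end Gluing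

section Posets

/-- A commutative square of posets is Cartesian if compatible pairs lift and the order can be
tested on the two projections. -/
lemma isPullback_partOrd {P A B C : PartOrd.{0}} {f : P ⟶ A} {g : P ⟶ B} {h : A ⟶ C} {k : B ⟶ C}
    (w : f ≫ h = g ≫ k) (hlift : ∀ a b, h a = k b → ∃ x, f x = a ∧ g x = b)
    (hle : ∀ x y, f x ≤ f y → g x ≤ g y → x ≤ y) : IsPullback f g h k := by
  choose l hl₁ hl₂ using hlift
  refine ⟨⟨w⟩, ⟨PullbackCone.IsLimit.mk w
    (fun s => PartOrd.ofHom ⟨fun x => l (s.fst x) (s.snd x) congr($(s.condition) x),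
      fun x y hxy => hle _ _ ?_ ?_⟩) (fun s => ?_) (fun s => ?_) fun s m h₁ h₂ => ?_⟩⟩
  · rw [hl₁, hl₁]
    exact s.fst.hom.monotone hxy
  · rw [hl₂, hl₂]
    exact s.snd.hom.monotone hxy
  · ext x
    exact hl₁ _ _ _
  · ext x
    exact hl₂ _ _ _
  · ext x
    refine le_antisymm (hle _ _ ?_ ?_) (hle _ _ ?_ ?_)
    · exact (congr($h₁ x).trans (hl₁ _ _ _).symm).le
    · exact (congr($h₂ x).trans (hl₂ _ _ _).symm).le
    · exact (congr($h₁ x).trans (hl₁ _ _ _).symm).ge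
    · exact (congr($h₂ x).trans (hl₂ _ _ _).symm).ge

end Posets

section Simplicial

variable {X : Over SpecC} {Fl : SimplicialObject (AffCᵒᵖ ⥤ PartOrd.{0})}
  {e : ∀ (n : ℕ) (S : AffC), (Fl _⦋n⦌).obj (op S) ≃o FlagTuple (proj X S) n}

/-- Faces and degeneracies determine the action of all simplicial operators. -/
lemma IsFlagSimplicialObject.map_apply (H : IsFlagSimplicialObject X Fl e) {m n : ℕ}
    (φ : ⦋m⦌ ⟶ ⦋n⦌) (S : AffC) (x : (Fl _⦋n⦌).obj (op S)) :
    (e m S ((Fl.map φ.op).app (op S) x)).1 = simplexAct φ.toOrderHom (e n S x).1 := by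
  let W : MorphismProperty SimplexCategory := fun m n φ =>
    ∀ (S : AffC) (x : (Fl.obj (op n)).obj (op S)),
      (e m.len S ((Fl.map φ.op).app (op S) x)).1 = simplexAct φ.toOrderHom (e n.len S x).1
  have hW : W.IsMultiplicative :=
    { id_mem m S x := by
        rw [op_id, Fl.map_id]
        exact (simplexAct_id _).symm
      comp_mem φ ψ hφ hψ S x := by
        rw [op_comp, Fl.map_comp]
        exact ((hφ S _).trans (congr_arg (simplexAct _) (hψ S x))).trans
          (simplexAct_comp _ _ _).symm }
  have := SimplexCategory.morphismProperty_eq_top W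
    (fun {n} i S x => (H.face n i S x).trans (face_eq_simplexAct _ _))
    (fun {n} i S x => (H.degeneracy n i S x).trans (degeneracy_eq_simplexAct _ _))
  have hφ : W φ := by rw [this]; trivial
  exact hφ S x

/-- A square of simplicial operators acts by Cartesian squares on flag tuples if every edge of the
big simplex lies on one of the two faces and if flag tuples on the two faces can be glued. -/
lemma IsFlagSimplicialObject.isPullback (H : IsFlagSimplicialObject X Fl e)
    (hX : IsSmoothProjectiveSurface X) {n a b c : ℕ}
    {φ : ⦋a⦌ ⟶ ⦋n⦌} {ψ : ⦋b⦌ ⟶ ⦋n⦌} {φ' : ⦋c⦌ ⟶ ⦋a⦌} {ψ' : ⦋c⦌ ⟶ ⦋b⦌} (w : φ' ≫ φ = ψ' ≫ ψ)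
    (hedge : ∀ j : Fin n,
      (∃ k : Fin a, φ.toOrderHom k.castSucc = j.castSucc ∧ φ.toOrderHom k.succ = j.succ) ∨
      (∃ k : Fin b, ψ.toOrderHom k.castSucc = j.castSucc ∧ ψ.toOrderHom k.succ = j.succ))
    (hglue : ∀ {M : Type} [CommMonoid M] {r : M → M → Prop}, IsPartialCommMonoid r →
      ∀ (G : Fin a → M) (G' : Fin b → M), IsComposable r G → IsComposable r G' →
        simplexAct φ'.toOrderHom G = simplexAct ψ'.toOrderHom G' →
        ∃ F : Fin n → M, IsComposable r F ∧ simplexAct φ.toOrderHom F = G ∧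
          simplexAct ψ.toOrderHom F = G')
    (S : AffC) :
    IsPullback ((Fl.map φ.op).app (op S)) ((Fl.map ψ.op).app (op S))
      ((Fl.map φ'.op).app (op S)) ((Fl.map ψ'.op).app (op S)) := by
  have := hX.isSeparated_proj S
  have := hX.locallyOfFinitePresentation_proj S
  have hr := isPartialCommMonoid_isGood (proj X S)
  refine isPullback_partOrd ?_ (fun G G' h => ?_) (fun x y h₁ h₂ => ?_)
  · rw [← NatTrans.comp_app, ← NatTrans.comp_app, ← Fl.map_comp, ← Fl.map_comp, ← op_comp,
      ← op_comp, w]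
  · have h' := congr_arg (fun z => (e c S z).1) h
    simp only [H.map_apply] at h'
    obtain ⟨F, hF, h₁, h₂⟩ := hglue hr (e a S G).1 (e b S G').1
      ((isFlagTuple_iff _ _ _).1 (e a S G).2) ((isFlagTuple_iff _ _ _).1 (e b S G').2) h'
    let T : FlagTuple (proj X S) n := ⟨F, (isFlagTuple_iff _ _ _).2 hF⟩
    have hT : (e n S ((e n S).symm T)).1 = F := congr_arg Subtype.val ((e n S).apply_symm_apply T)
    refine ⟨(e n S).symm T, (e a S).injective (Subtype.ext ?_),
      (e b S).injective (Subtype.ext ?_)⟩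
    · rw [H.map_apply, hT, h₁]
    · rw [H.map_apply, hT, h₂]
  · rw [← (e n S).le_iff_le]
    rw [← (e a S).le_iff_le] at h₁
    rw [← (e b S).le_iff_le] at h₂
    intro j
    have key : ∀ (F : Fin n → SubPair (prodScheme X S)), segProd F j.castSucc j.succ = F j :=
      fun F => segProd_succ F j.is_lt
    obtain ⟨k, hk, hk'⟩ | ⟨k, hk, hk'⟩ := hedge j
    · have := h₁ k
      rw [H.map_apply, H.map_apply, simplexAct, simplexAct, hk, hk', key, key] at this
      exact this
    · have := h₂ k
      rw [H.map_apply, H.map_apply, simplexAct, simplexAct, hk, hk', key, key] at this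
      exact this

end Simplicial

/-! ### Segal squares -/

section Segal

variable {X : Over SpecC} {Fl : SimplicialObject (AffCᵒᵖ ⥤ PartOrd.{0})}
  {e : ∀ (n : ℕ) (S : AffC), (Fl _⦋n⦌).obj (op S) ≃o FlagTuple (proj X S) n}

lemma IsFlagSimplicialObject.isTwoSegal (H : IsFlagSimplicialObject X Fl e)
    (hX : IsSmoothProjectiveSurface X) : IsTwoSegal Fl := by
  intro a m b hm
  refine IsPullback.of_forall_isPullback_app fun S => ?_
  refine H.isPullback hX (φ := outerMap a m b hm) (ψ := innerMap a m b) (φ' := innerMap a 1 b)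
    (ψ' := edgeMap m) ?_ (fun j => ?_) (fun hr G G' hG hG' h => ?_) S.unop
  · ext k : 3
    have hk : k.val = 0 ∨ k.val = 1 := by have := k.is_lt; simp at this; omega
    refine Fin.ext ?_
    change (if a + k.val ≤ a then a + k.val else a + k.val - 1 + m) = a + k.val * m
    obtain hk | hk := hk <;> rw [hk] <;> simp
  · have hj := j.is_lt
    rcases lt_or_ge j.val a with hja | hja
    · refine Or.inl ⟨⟨j, by omega⟩, Fin.ext ?_, Fin.ext ?_⟩
      · exact if_pos hja.le
      · exact if_pos hja
    rcases lt_or_ge j.val (a + m) with hjm | hjm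
    · refine Or.inr ⟨⟨j - a, by omega⟩, Fin.ext ?_, Fin.ext ?_⟩
      · change a + (j.val - a) = j.val
        omega
      · change a + (j.val - a + 1) = j.val + 1
        omega
    · refine Or.inl ⟨⟨j + 1 - m, by omega⟩, Fin.ext ?_, Fin.ext ?_⟩
      · change (if j.val + 1 - m ≤ a then j.val + 1 - m else j.val + 1 - m - 1 + m) = j.val
        split_ifs <;> omega
      · change (if j.val + 1 - m + 1 ≤ a then j.val + 1 - m + 1 else j.val + 1 - m + 1 - 1 + m) =
          j.val + 1
        split_ifs <;> omega
  · refine hr.exists_glue_edge (fun _ => rfl) (fun _ => rfl) hG hG' ?_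
    have h₀ : segProd G (a + 0) (a + 1) = segProd G' (0 * m) (1 * m) := congr_fun h 0
    rwa [Nat.zero_mul, Nat.one_mul, segProd_succ' G (by omega) rfl] at h₀

lemma IsFlagSimplicialObject.isPullback_δ_zero (H : IsFlagSimplicialObject X Fl e)
    (hX : IsSmoothProjectiveSurface X) {n : ℕ} {i : Fin (n + 2)} (hi : 0 < i)
    (hi' : i < Fin.last (n + 1)) (S : AffC) :
    IsPullback ((Fl.δ i.succ).app (op S)) ((Fl.δ (0 : Fin (n + 3))).app (op S))
      ((Fl.δ (0 : Fin (n + 2))).app (op S)) ((Fl.δ i).app (op S)) := by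
  refine H.isPullback hX (φ := SimplexCategory.δ i.succ) (ψ := SimplexCategory.δ 0)
    (φ' := SimplexCategory.δ 0) (ψ' := SimplexCategory.δ i)
    (SimplexCategory.δ_comp_δ (Fin.zero_le i)) (fun j => ?_)
    (fun hr G G' hG hG' h => hr.exists_glue_zero hi hi' hG hG' h) S
  induction j using Fin.cases with
  | zero =>
    refine Or.inl ⟨0, Fin.ext ?_, Fin.ext ?_⟩
    · exact (val_succAbove _ _).trans (if_pos (by simp))
    · exact (val_succAbove _ _).trans (if_pos (by simpa using hi))
  | succ j => exact Or.inr ⟨j, rfl, rfl⟩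

lemma IsFlagSimplicialObject.isPullback_δ_last (H : IsFlagSimplicialObject X Fl e)
    (hX : IsSmoothProjectiveSurface X) {n : ℕ} {i : Fin (n + 2)} (hi : 0 < i)
    (hi' : i < Fin.last (n + 1)) (S : AffC) :
    IsPullback ((Fl.δ i.castSucc).app (op S)) ((Fl.δ (Fin.last (n + 2))).app (op S))
      ((Fl.δ (Fin.last (n + 1))).app (op S)) ((Fl.δ i).app (op S)) := by
  refine H.isPullback hX (φ := SimplexCategory.δ i.castSucc) (ψ := SimplexCategory.δ (Fin.last _))
    (φ' := SimplexCategory.δ (Fin.last _)) (ψ' := SimplexCategory.δ i)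
    (SimplexCategory.δ_comp_δ (Fin.le_last i)).symm (fun j => ?_)
    (fun hr G G' hG hG' h => hr.exists_glue_last hi hi' hG hG' h) S
  induction j using Fin.lastCases with
  | last =>
    refine Or.inl ⟨Fin.last _, Fin.ext ?_, Fin.ext ?_⟩
    · exact (val_succAbove _ _).trans (if_neg (not_lt.2 (Nat.le_of_lt_succ hi')))
    · exact (val_succAbove _ _).trans (if_neg (not_lt.2 hi'.le))
  | cast j =>
    exact Or.inr ⟨j, Fin.succAbove_last_apply _, Fin.succAbove_last_apply _⟩

end Segal

end FlagSegal

theorem theorem5 (X : Over FlagSegal.SpecC) (hX : FlagSegal.IsSmoothProjectiveSurface X) :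
    -- the simplicial object of flags exists
    (∃ (Fl : SimplicialObject (FlagSegal.AffCᵒᵖ ⥤ PartOrd.{0}))
      (e : ∀ (n : ℕ) (S : FlagSegal.AffC),
        (Fl _⦋n⦌).obj (op S) ≃o FlagSegal.FlagTuple (FlagSegal.proj X S) n),
      FlagSegal.IsFlagSimplicialObject X Fl e) ∧
    -- it is 2-Segal, and its 2-Segal squares are strictly Cartesian over every test scheme
    (∀ (Fl : SimplicialObject (FlagSegal.AffCᵒᵖ ⥤ PartOrd.{0}))
      (e : ∀ (n : ℕ) (S : FlagSegal.AffC),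
        (Fl _⦋n⦌).obj (op S) ≃o FlagSegal.FlagTuple (FlagSegal.proj X S) n),
      FlagSegal.IsFlagSimplicialObject X Fl e →
      FlagSegal.IsTwoSegal Fl ∧
      ∀ (n : ℕ) (i : Fin (n + 2)), 0 < i → i < Fin.last (n + 1) → ∀ S : FlagSegal.AffC,
        IsPullback ((Fl.δ i.succ).app (op S)) ((Fl.δ (0 : Fin (n + 3))).app (op S))
          ((Fl.δ (0 : Fin (n + 2))).app (op S)) ((Fl.δ i).app (op S)) ∧
        IsPullback ((Fl.δ i.castSucc).app (op S)) ((Fl.δ (Fin.last (n + 2))).app (op S))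
          ((Fl.δ (Fin.last (n + 1))).app (op S)) ((Fl.δ i).app (op S))) ∧
    -- the members of a flag tuple are pairwise good
    (∀ (S : FlagSegal.AffC) (n : ℕ) (F : FlagSegal.FlagTuple (FlagSegal.proj X S) n)
      (i j : Fin n), i ≠ j → (F.1 i).IsGood (FlagSegal.proj X S) (F.1 j)) ∧
    -- the union of good pairs is a partially defined unital associative monoid structure
    (∀ (S : FlagSegal.AffC) (F G H : FlagSegal.SubPair (FlagSegal.prodScheme X S)),
      (F.IsFlag (FlagSegal.proj X S) →
        F.IsGood (FlagSegal.proj X S) (FlagSegal.SubPair.empty _) ∧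
        F.union (FlagSegal.SubPair.empty _) = F ∧
        (FlagSegal.SubPair.empty _).IsGood (FlagSegal.proj X S) F ∧
        (FlagSegal.SubPair.empty _).union F = F) ∧
      (F.IsGood (FlagSegal.proj X S) G → (F.union G).IsFlag (FlagSegal.proj X S)) ∧
      ((F.IsGood (FlagSegal.proj X S) G ∧ (F.union G).IsGood (FlagSegal.proj X S) H) ↔
        (G.IsGood (FlagSegal.proj X S) H ∧ F.IsGood (FlagSegal.proj X S) (G.union H))) ∧
      (F.union G).union H = F.union (G.union H)) := by
  refine ⟨⟨_, _, FlagSegal.isFlagSimplicialObject_flagSimplicial hX⟩,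
    fun Fl e H => ⟨H.isTwoSegal hX, fun n i hi hi' S =>
      ⟨H.isPullback_δ_zero hX hi hi' S, H.isPullback_δ_last hX hi hi' S⟩⟩,
    fun S n F i j hij => ?_, fun S F G H => ?_⟩ <;>
  have := hX.isSeparated_proj S <;>
  have := hX.locallyOfFinitePresentation_proj S <;>
  have hr := FlagSegal.isPartialCommMonoid_isGood (FlagSegal.proj X S)
  · exact hr.pairwise ((FlagSegal.isFlagTuple_iff _ _ _).1 F.2) hij
  · exact ⟨fun hF => ⟨FlagSegal.isGood_empty hF, mul_one F,
      FlagSegal.isGood_symm (FlagSegal.isGood_empty hF), one_mul F⟩, FlagSegal.isFlag_union,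
      ⟨fun h => hr.assoc h.1 h.2, fun h => hr.assoc' h.1 h.2⟩, mul_assoc F G H⟩
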